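/- Let $L_0 u=-u''$ be the operator in the complex Hilbert space $L^2(\mathbb R)$ with domain $C_c^\infty(\mathbb R)$. Then $L_0$ is essentially self-adjoint, i.e. it is closable and its closure is self-adjoint. It has exactly one self-adjoint extension $L$, and $$\sigma(L)=\sigma_{\mathrm{ac}}(L)=[0,\infty).$$ Moreover the spectrum is purely absolutely continuous: $L$ has a spectral resolution $E$ (a projection-valued Borel measure on $\mathbb R$ with $L=\int\lambda\,dE(\lambda)$), and for every $f\in L^2(\mathbb R)$ the measure $\Delta\mapsto\langle f,E(\Delta)f\rangle$ is absolutely continuous with respect to Lebesgue measure. Here $\sigma_{\mathrm{ac}}(L)$ is the spectrum of the part of $L$ in the subspace of all $f$ with this property. For all real $a<b$, with $\mathbf 1_\Delta(L)=E(\Delta)$ and with $\mathbf 1_{(a,b)}$ also denoting multiplication by the indicator function of $(a,b)$, the operator $\mathbf 1_{(-\infty,\pi^2)}(L)\,\mathbf 1_{(a,b)}$ on $L^2(\mathbb R)$ is of trace class, its trace is $b-a$, and it is the integral operator with kernel $K_{\mathrm{Dyson}}(x,y)\,\mathbf 1_{(a,b)}(y)$, that is, for every $f\in L^2(\mathbb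 R)$ and almost every $x\in\mathbb R$, $$\bigl(\mathbf 1_{(-\infty,\pi^2)}(L)\,\mathbf 1_{(a,b)}f\bigr)(x)=\int_a^b K_{\mathrm{Dyson}}(x,y)\,f(y)\,dy,$$ where, for all $x,y\in\mathbb R$, $$K_{\mathrm{Dyson}}(x,y)=\int_0^{\pi^2}\frac{\cos\bigl((x-y)\sqrt\lambda\bigr)}{2\pi\sqrt\lambda}\,d\lambda=\frac{\sin(\pi(x-y))}{\pi(x-y)},$$ the last quotient being read as $1$ when $x=y$. -/

import Mathlib

open MeasureTheory Set
open scoped ContDiff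

noncomputable section

namespace FreeLaplacian

/-! ### Unbounded operators: essential self-adjointness, spectrum, parts -/

section Unbounded

/-- A partially defined operator is essentially self-adjoint if it is closable and its closure is
self-adjoint (in particular it is then densely defined and symmetric). -/
def IsEssentiallySelfAdjoint {H : Type*} [NormedAddCommGroup H] [InnerProductSpace ℂ H]
    [CompleteSpace H] (T : H →ₗ.[ℂ] H) : Prop :=
  T.IsClosable ∧ IsSelfAdjoint T.closure

/-- The resolvent set of a partially defined operator: the `z` for which `T - z` is a bijection of
the domain onto the whole space with a bounded inverse `R`. -/
def resolventSet {H : Type*} [NormedAddCommGroup H] [NormedSpace ℂ H] (T : H →ₗ.[ℂ] H) : Set ℂ :=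
  {z | ∃ R : H →L[ℂ] H,
    (∀ y : H, ∃ x : T.domain, (x : H) = R y ∧ T x - z • (x : H) = y) ∧
    ∀ x : T.domain, R (T x - z • (x : H)) = x}

/-- The spectrum of a partially defined operator. -/
def opSpectrum {H : Type*} [NormedAddCommGroup H] [NormedSpace ℂ H] (T : H →ₗ.[ℂ] H) : Set ℂ :=
  (resolventSet T)ᶜ

/-- The part of `T` in the subspace `K`: the restriction of `T` to
`{x ∈ K | x ∈ D(T), T x ∈ K}`, as an operator in `K`. -/
def part {H : Type*} [NormedAddCommGroup H] [NormedSpace ℂ H] (T : H →ₗ.[ℂ] H)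
    (K : Submodule ℂ H) : K →ₗ.[ℂ] K where
  domain :=
    { carrier := {x | ∃ h : (x : H) ∈ T.domain, T ⟨x, h⟩ ∈ K}
      zero_mem' := ⟨T.domain.zero_mem, by
        have : T ⟨((0 : K) : H), T.domain.zero_mem⟩ = 0 := T.map_zero
        rw [this]; exact K.zero_mem⟩
      add_mem' := by
        rintro x y ⟨hx, hx'⟩ ⟨hy, hy'⟩
        refine ⟨T.domain.add_mem hx hy, ?_⟩
        have : T ⟨((x + y : K) : H), T.domain.add_mem hx hy⟩ = T ⟨x, hx⟩ + T ⟨y, hy⟩ :=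
          T.map_add ⟨x, hx⟩ ⟨y, hy⟩
        rw [this]; exact K.add_mem hx' hy'
      smul_mem' := by
        rintro c x ⟨hx, hx'⟩
        refine ⟨T.domain.smul_mem c hx, ?_⟩
        have : T ⟨((c • x : K) : H), T.domain.smul_mem c hx⟩ = c • T ⟨x, hx⟩ :=
          T.map_smul c ⟨x, hx⟩
        rw [this]; exact K.smul_mem c hx' }
  toFun :=
    { toFun := fun x => ⟨T ⟨((x : K) : H), x.2.1⟩, x.2.2⟩
      map_add' := fun x y => Subtype.ext (T.map_add ⟨((x : K) : H), x.2.1⟩ ⟨((y : K) : H), y.2.1⟩)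
      map_smul' := fun c x => Subtype.ext (T.map_smul c ⟨((x : K) : H), x.2.1⟩) }

end Unbounded

/-! ### Spectral resolutions -/

section Spectral

/-- A projection-valued measure on the Borel sets of `ℝ`: orthogonal projections, strongly
countably additive, with total mass the identity.
(The values on non-measurable sets are irrelevant.) -/
structure ProjectionValuedMeasure (H : Type*) [NormedAddCommGroup H] [InnerProductSpace ℂ H]
    [CompleteSpace H] where
  proj : Set ℝ → H →L[ℂ] H
  isStarProjection : ∀ s, MeasurableSet s → IsStarProjection (proj s)
  proj_univ : proj univ = 1
  hasSum_iUnion : ∀ s : ℕ → Set ℝ, (∀ n, MeasurableSet (s n)) →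
    Pairwise (fun m n => Disjoint (s m) (s n)) →
    ∀ x, HasSum (fun n => proj (s n) x) (proj (⋃ n, s n) x)

variable {H : Type*} [NormedAddCommGroup H] [InnerProductSpace ℂ H] [CompleteSpace H]

namespace ProjectionValuedMeasure

theorem norm_sq_eq (E : ProjectionValuedMeasure H) {s : Set ℝ} (hs : MeasurableSet s) (x : H) :
    ‖E.proj s x‖ ^ 2 = RCLike.re (inner ℂ x (E.proj s x)) := by
  have h := E.isStarProjection s hs
  have h1 : E.proj s (E.proj s x) = E.proj s x := by
    have := congrArg (fun A : H →L[ℂ] H => A x) h.isIdempotentElem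
    simpa using this
  have h2 : inner ℂ (E.proj s x) (E.proj s x) = inner ℂ x (E.proj s (E.proj s x)) :=
    h.isSelfAdjoint.isSymmetric x (E.proj s x)
  rw [h1] at h2
  rw [← h2, ← inner_self_eq_norm_sq (𝕜 := ℂ)]

theorem proj_empty (E : ProjectionValuedMeasure H) (x : H) : E.proj ∅ x = 0 := by
  have h := E.hasSum_iUnion (fun _ => ∅) (fun _ => MeasurableSet.empty) (by intro m n _; simp) x
  exact tendsto_nhds_unique tendsto_const_nhds h.summable.tendsto_atTop_zero

/-- The spectral measure of a vector: `μ_x(Δ) = ‖E(Δ) x‖² = ⟨x, E(Δ) x⟩` for Borel `Δ`. -/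
def vectorMeasure (E : ProjectionValuedMeasure H) (x : H) : Measure ℝ :=
  Measure.ofMeasurable (fun s _ => ENNReal.ofReal (‖E.proj s x‖ ^ 2))
    (by simp [E.proj_empty x])
    (by
      intro s hs hd
      have h := E.hasSum_iUnion s hs hd x
      have h2 : HasSum (fun n => ‖E.proj (s n) x‖ ^ 2) (‖E.proj (⋃ n, s n) x‖ ^ 2) := by
        rw [E.norm_sq_eq (MeasurableSet.iUnion hs)]
        simp_rw [E.norm_sq_eq (hs _)]
        exact ((h.mapL (innerSL ℂ x)).mapL (RCLike.reCLM (K := ℂ)))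
      rw [← h2.tsum_eq, ENNReal.ofReal_tsum_of_nonneg (fun _ => by positivity) h2.summable])

theorem vectorMeasure_apply (E : ProjectionValuedMeasure H) (x : H) {s : Set ℝ}
    (hs : MeasurableSet s) : E.vectorMeasure x s = ENNReal.ofReal (‖E.proj s x‖ ^ 2) :=
  Measure.ofMeasurable_apply s hs

/-- The absolutely continuous subspace: the vectors whose spectral measure is absolutely continuous
with respect to Lebesgue measure. -/
def acSubspace (E : ProjectionValuedMeasure H) : Submodule ℂ H where
  carrier := {x | E.vectorMeasure x ≪ volume}
  zero_mem' := by
    refine Measure.AbsolutelyContinuous.mk fun s hs _ => ?_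
    simp [E.vectorMeasure_apply _ hs]
  add_mem' := by
    intro x y hx hy
    refine Measure.AbsolutelyContinuous.mk fun s hs h0 => ?_
    have h1 := hx h0
    have h2 := hy h0
    rw [E.vectorMeasure_apply _ hs, ENNReal.ofReal_eq_zero] at h1 h2 ⊢
    have h3 : E.proj s x = 0 := by
      simpa using le_antisymm h1 (sq_nonneg _)
    have h4 : E.proj s y = 0 := by
      simpa using le_antisymm h2 (sq_nonneg _)
    simp [h3, h4]
  smul_mem' := by
    intro c x hx
    refine Measure.AbsolutelyContinuous.mk fun s hs h0 => ?_
    have h1 := hx h0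
    rw [E.vectorMeasure_apply _ hs, ENNReal.ofReal_eq_zero] at h1 ⊢
    have h3 : E.proj s x = 0 := by
      simpa using le_antisymm h1 (sq_nonneg _)
    simp [h3]

end ProjectionValuedMeasure

/-- `E` is the spectral resolution of `T`, i.e. `T = ∫ t dE(t)`: the domain consists of the `x` with
`∫ t² dμ_x(t) < ∞`, and `⟨x, T x⟩ = ∫ t dμ_x(t)` there. For this `E`, the functional calculus
gives `1_Δ(T) = E(Δ)`. -/
def IsSpectralResolution (T : H →ₗ.[ℂ] H) (E : ProjectionValuedMeasure H) : Prop :=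
  (∀ x : H, x ∈ T.domain ↔ ∫⁻ t : ℝ, ENNReal.ofReal (t ^ 2) ∂(E.vectorMeasure x) < (⊤ : ENNReal)) ∧
  ∀ x : T.domain, inner ℂ (x : H) (T x) = ((∫ t : ℝ, t ∂(E.vectorMeasure (x : H)) : ℝ) : ℂ)

/-- The absolutely continuous spectrum of `T`: the spectrum of the part of `T` in the absolutely
continuous subspace of its spectral resolution `E`. -/
def acSpectrum (T : H →ₗ.[ℂ] H) (E : ProjectionValuedMeasure H) : Set ℂ :=
  opSpectrum (part T E.acSubspace)

/-- Trace class (nuclear) operators: `A = ∑ ⟨u_n, ·⟩ v_n` with `∑ ‖u_n‖ ‖v_n‖ < ∞`. -/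
def IsTraceClass (A : H →L[ℂ] H) : Prop :=
  ∃ u v : ℕ → H, Summable (fun n => ‖u n‖ * ‖v n‖) ∧
    ∀ x, HasSum (fun n => inner ℂ (u n) x • v n) (A x)

/-- `A` has trace `t`: `∑ ⟨e_i, A e_i⟩ = t`, absolutely, for every orthonormal basis. -/
def HasTrace (A : H →L[ℂ] H) (t : ℂ) : Prop :=
  ∀ (ι : Type) (e : HilbertBasis ι ℂ H), HasSum (fun i => inner ℂ (e i) (A (e i))) t

end Spectral

/-! ### The operator `-u''` and multiplication operators on `L²(ℝ)` -/

/-- The complex Hilbert space `L²(ℝ)`. -/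
abbrev L2 : Type := Lp ℂ 2 (volume : Measure ℝ)

/-- The space of smooth compactly supported functions `ℝ → ℂ`. -/
def testFunctions : Submodule ℂ (ℝ → ℂ) where
  carrier := {φ | ContDiff ℝ ∞ φ ∧ HasCompactSupport φ}
  zero_mem' := ⟨contDiff_const, HasCompactSupport.zero⟩
  add_mem' := fun hφ hψ => ⟨hφ.1.add hψ.1, hφ.2.add hψ.2⟩
  smul_mem' := fun c _ hφ => ⟨contDiff_const.smul hφ.1, hφ.2.smul_left (f := fun _ => c)⟩

theorem testFunctions_memLp (φ : testFunctions) : MemLp (φ : ℝ → ℂ) 2 (volume : Measure ℝ) :=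
  φ.2.1.continuous.memLp_of_hasCompactSupport φ.2.2

/-- A test function as an element of `L²(ℝ)`. -/
def testToL2 : testFunctions →ₗ[ℂ] L2 where
  toFun φ := (testFunctions_memLp φ).toLp φ
  map_add' φ ψ := MemLp.toLp_add (testFunctions_memLp φ) (testFunctions_memLp ψ)
  map_smul' c φ := MemLp.toLp_const_smul c (testFunctions_memLp φ)

theorem testToL2_injective : Function.Injective testToL2 := by
  intro φ ψ h
  have h1 : (φ : ℝ → ℂ) =ᵐ[volume] (ψ : ℝ → ℂ) :=
    (MemLp.toLp_eq_toLp_iff (testFunctions_memLp φ) (testFunctions_memLp ψ)).1 h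
  exact Subtype.ext ((φ.2.1.continuous.ae_eq_iff_eq volume ψ.2.1.continuous).1 h1)

theorem testFunctions_deriv {φ : ℝ → ℂ} (hφ : φ ∈ testFunctions) : deriv φ ∈ testFunctions :=
  ⟨ContDiff.deriv' (n := ∞) hφ.1, hφ.2.deriv⟩

/-- `φ ↦ -φ''` on test functions. -/
def negSecondDeriv : testFunctions →ₗ[ℂ] testFunctions where
  toFun φ := -⟨deriv (deriv φ), testFunctions_deriv (testFunctions_deriv φ.2)⟩
  map_add' φ ψ := by
    have hd : ∀ χ : testFunctions, Differentiable ℝ (χ : ℝ → ℂ) := fun χ =>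
      χ.2.1.differentiable (by simp)
    have h1 : deriv ((φ : ℝ → ℂ) + (ψ : ℝ → ℂ)) = deriv (φ : ℝ → ℂ) + deriv (ψ : ℝ → ℂ) :=
      funext fun x => deriv_add (hd φ x) (hd ψ x)
    have h2 : deriv (deriv (φ : ℝ → ℂ) + deriv (ψ : ℝ → ℂ))
        = deriv (deriv (φ : ℝ → ℂ)) + deriv (deriv (ψ : ℝ → ℂ)) :=
      funext fun x => deriv_add (hd ⟨_, testFunctions_deriv φ.2⟩ x)
        (hd ⟨_, testFunctions_deriv ψ.2⟩ x)
    apply Subtype.ext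
    change -deriv (deriv ((φ : ℝ → ℂ) + (ψ : ℝ → ℂ))) = -deriv (deriv (φ : ℝ → ℂ)) + -deriv (deriv (ψ : ℝ → ℂ))
    rw [h1, h2, neg_add]
  map_smul' c φ := by
    have h1 : ∀ f : ℝ → ℂ, deriv (c • f) = c • deriv f := fun f =>
      funext fun x => deriv_const_smul_field c f
    apply Subtype.ext
    change -deriv (deriv (c • (φ : ℝ → ℂ))) = c • -deriv (deriv (φ : ℝ → ℂ))
    rw [h1, h1, smul_neg]

/-- The operator `u ↦ -u''` in `L²(ℝ)` with domain the smooth compactly supported functions. -/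
def minimalOperator : L2 →ₗ.[ℂ] L2 where
  domain := LinearMap.range testToL2
  toFun := testToL2 ∘ₗ negSecondDeriv ∘ₗ
    (LinearEquiv.ofInjective testToL2 testToL2_injective).symm.toLinearMap

theorem minimalOperator_apply (φ : testFunctions) :
    minimalOperator ⟨testToL2 φ, LinearMap.mem_range_self testToL2 φ⟩
      = testToL2 (negSecondDeriv φ) := by
  have h : (LinearEquiv.ofInjective testToL2 testToL2_injective).symm
      ⟨testToL2 φ, LinearMap.mem_range_self testToL2 φ⟩ = φ :=
    (LinearEquiv.ofInjective testToL2 testToL2_injective).symm_apply_apply φ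
  change testToL2 (negSecondDeriv ((LinearEquiv.ofInjective testToL2 testToL2_injective).symm
      ⟨testToL2 φ, LinearMap.mem_range_self testToL2 φ⟩)) = _
  rw [h]

theorem memLp_indicator (a b : ℝ) (f : L2) :
    MemLp ((Ioo a b).indicator (f : ℝ → ℂ)) 2 (volume : Measure ℝ) :=
  (Lp.memLp f).indicator measurableSet_Ioo

/-- Multiplication by the indicator function of `(a, b)` on `L²(ℝ)`, as a linear map. -/
def indicatorMulLin (a b : ℝ) : L2 →ₗ[ℂ] L2 where
  toFun f := (memLp_indicator a b f).toLp _
  map_add' f g := by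
    rw [← MemLp.toLp_add, MemLp.toLp_eq_toLp_iff]
    filter_upwards [Lp.coeFn_add f g] with x hx
    by_cases h : x ∈ Ioo a b
    · simpa only [Set.indicator_of_mem h, Pi.add_apply] using hx
    · simp only [Set.indicator_of_notMem h, Pi.add_apply, add_zero]
  map_smul' c f := by
    rw [RingHom.id_apply, ← MemLp.toLp_const_smul, MemLp.toLp_eq_toLp_iff]
    filter_upwards [Lp.coeFn_smul c f] with x hx
    by_cases h : x ∈ Ioo a b
    · simpa only [Set.indicator_of_mem h, Pi.smul_apply] using hx
    · simp only [Set.indicator_of_notMem h, Pi.smul_apply, smul_zero]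

theorem indicatorMulLin_coeFn (a b : ℝ) (f : L2) :
    indicatorMulLin a b f =ᵐ[volume] (Ioo a b).indicator (f : ℝ → ℂ) :=
  MemLp.coeFn_toLp (memLp_indicator a b f)

theorem indicatorMulLin_norm_le (a b : ℝ) (f : L2) : ‖indicatorMulLin a b f‖ ≤ 1 * ‖f‖ := by
  rw [one_mul]
  refine Lp.norm_le_norm_of_ae_le ?_
  filter_upwards [indicatorMulLin_coeFn a b f] with x hx
  rw [hx]
  exact norm_indicator_le_norm_self (f : ℝ → ℂ) x

/-- Multiplication by the indicator function of `(a, b)` as a bounded operator on `L²(ℝ)`. -/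
def indicatorMul (a b : ℝ) : L2 →L[ℂ] L2 :=
  (indicatorMulLin a b).mkContinuous 1 (indicatorMulLin_norm_le a b)

/-- `A` is the integral operator on `L²(ℝ)` with kernel `k`. -/
def HasKernel (A : L2 →L[ℂ] L2) (k : ℝ → ℝ → ℂ) : Prop :=
  ∀ f : L2, ∀ᵐ x : ℝ, Integrable (fun y => k x y * f y) ∧ A f x = ∫ y, k x y * f y

/-- The integrand `cos((x-y)√t) / (2π√t)` of the Dyson kernel. -/
def dysonIntegrand (x y t : ℝ) : ℝ :=
  Real.cos ((x - y) * Real.sqrt t) / (2 * Real.pi * Real.sqrt t)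

/-- The Dyson kernel `∫₀^{π²} cos((x-y)√t) / (2π√t) dt`. -/
def dysonKernel (x y : ℝ) : ℝ :=
  ∫ t in (0 : ℝ)..Real.pi ^ 2, dysonIntegrand x y t

end FreeLaplacian

end

open FreeLaplacian

noncomputable section

namespace FreeLaplacian

open scoped Topology ENNReal FourierTransform SchwartzMap

/-! ### Multiplication operators on `L²(ℝ)` -/

/-! The Fourier transform turns `-u''` into multiplication by `symb ξ = (2πξ)²`, so the extension is
taken to be `freeL`, the maximal multiplication operator conjugated by `FT`. Statements about it
reduce to a.e. identities on the Fourier side through `mem_freeL_graph`. It is symmetric because the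
symbol is real, and self-adjoint because `symb ∓ i` has a bounded inverse. Its spectrum is the
closed range `[0, ∞)` of the symbol: bounded inverses exist off it, and indicators concentrated in
frequency are approximate eigenvectors on it.

Essential self-adjointness is the density of test functions in the graph of `freeL`
(`closure_minimalOperator`). Dilated cutoffs put every Schwartz pair `(ψ, -ψ'')` in the closure of
the minimal graph, and the parametrization `graphParam` carries a dense set of `h` to such pairs.
Uniqueness follows, since a self-adjoint extension contains the closure and a self-adjoint operator
is maximal among self-adjoint ones.

The spectral projection `E(Δ)` is the Fourier multiplier by the indicator of `symb⁻¹(Δ)`. Hence the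
spectral measure of `f` is the pushforward of `|FT f|² dξ` under `symb` (`freePVM_vectorMeasure`).
As preimages of null sets under `symb` are null, all these measures are absolutely continuous.

For `Δ = (-∞, π²)` the frequency window is `(-1/2, 1/2)`. Expanding `exp(-2πi y ξ)` in its Taylor
series in `yξ` separates the variables and writes the band operator as a nuclear series with
factorially decaying terms (`hasSum_bandOp`). For such a series the trace is the sum of the pairings
of its factors (`hasTrace_of_hasSum`); here the exponentials recombine to `1`, and the trace is the
area of `(a, b) × (-1/2, 1/2)`. The kernel is the inverse Fourier transform of the window, a sinc,
and it equals the Dyson integral by an explicit antiderivative. -/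

theorem memLp_bounded_mul {c : ℝ → ℂ} (hc : Measurable c) {C : ℝ} (hC : ∀ x, ‖c x‖ ≤ C)
    {f : ℝ → ℂ} (hf : MemLp f 2 (volume : Measure ℝ)) :
    MemLp (fun x => c x * f x) 2 (volume : Measure ℝ) :=
  hf.of_le_mul (c := C) (hc.aestronglyMeasurable.mul hf.1) <| ae_of_all _ fun x => by
    rw [norm_mul]; gcongr; exact hC x

/-- Multiplication by a bounded measurable function on `L²(ℝ)`; zero for other functions. -/
def mulOp (c : ℝ → ℂ) : L2 →L[ℂ] L2 :=
  open Classical in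
  if h : Measurable c ∧ ∃ C, ∀ x, ‖c x‖ ≤ C then
    LinearMap.mkContinuous
      { toFun := fun f => (memLp_bounded_mul h.1 h.2.choose_spec (Lp.memLp f)).toLp _
        map_add' := fun f g => by
          rw [← MemLp.toLp_add, MemLp.toLp_eq_toLp_iff]
          filter_upwards [Lp.coeFn_add f g] with x hx
          simp only [hx, Pi.add_apply, mul_add]
        map_smul' := fun a f => by
          rw [RingHom.id_apply, ← MemLp.toLp_const_smul, MemLp.toLp_eq_toLp_iff]
          filter_upwards [Lp.coeFn_smul a f] with x hx
          simp only [hx, Pi.smul_apply, smul_eq_mul]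
          ring }
      h.2.choose
      (fun f => Lp.norm_le_mul_norm_of_ae_le_mul <| by
        filter_upwards [MemLp.coeFn_toLp (memLp_bounded_mul h.1 h.2.choose_spec (Lp.memLp f))]
          with x hx
        simp only [LinearMap.coe_mk, AddHom.coe_mk]
        rw [hx, norm_mul]; gcongr; exact h.2.choose_spec x)
  else 0

theorem mulOp_coeFn {c : ℝ → ℂ} (hc : Measurable c) {C : ℝ} (hC : ∀ x, ‖c x‖ ≤ C) (f : L2) :
    mulOp c f =ᵐ[volume] fun x => c x * f x := by
  have h : Measurable c ∧ ∃ C, ∀ x, ‖c x‖ ≤ C := ⟨hc, C, hC⟩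
  rw [mulOp, dif_pos h]
  exact MemLp.coeFn_toLp (memLp_bounded_mul h.1 h.2.choose_spec (Lp.memLp f))

/-- The multiplier with symbol the indicator function of `s`. -/
def indOp (s : Set ℝ) : L2 →L[ℂ] L2 := mulOp (s.indicator 1)

theorem norm_indicator_one_le (s : Set ℝ) (x : ℝ) : ‖s.indicator (1 : ℝ → ℂ) x‖ ≤ 1 := by
  by_cases h : x ∈ s <;> simp [h]

theorem indOp_coeFn {s : Set ℝ} (hs : MeasurableSet s) (f : L2) :
    indOp s f =ᵐ[volume] s.indicator f := by
  filter_upwards [mulOp_coeFn (measurable_one.indicator hs) (norm_indicator_one_le s) f] with x hx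
  rw [indOp, hx]
  by_cases h : x ∈ s <;> simp [h]

/-- Dominated convergence in `L²(ℝ)`. -/
theorem tendsto_L2_of_dominated {ι : Type*} {l : Filter ι} [l.IsCountablyGenerated] {F : ι → L2}
    {f : L2} {g : ℝ → ℝ} (hg : MemLp g 2 (volume : Measure ℝ))
    (hb : ∀ i, ∀ᵐ x : ℝ, ‖F i x - f x‖ ≤ g x)
    (hl : ∀ᵐ x : ℝ, Filter.Tendsto (fun i => F i x) l (𝓝 (f x))) : Filter.Tendsto F l (𝓝 f) := by
  rw [Lp.tendsto_Lp_iff_tendsto_eLpNorm']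
  simp_rw [eLpNorm_eq_lintegral_rpow_enorm_toReal (p := 2) two_ne_zero ENNReal.ofNat_ne_top]
  have key : Filter.Tendsto (fun i => ∫⁻ x : ℝ, ‖(⇑(F i) - ⇑f) x‖ₑ ^ (2 : ℝ≥0∞).toReal) l
      (𝓝 (∫⁻ _ : ℝ, 0)) := by
    refine tendsto_lintegral_filter_of_dominated_convergence
      (fun x => ‖g x‖ₑ ^ (2 : ℝ≥0∞).toReal) ?_ ?_ ?_ ?_
    · refine Filter.Eventually.of_forall fun i => ?_
      exact (((Lp.stronglyMeasurable (F i)).sub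
        (Lp.stronglyMeasurable f)).measurable.enorm.pow_const _)
    · refine Filter.Eventually.of_forall fun i => ?_
      filter_upwards [hb i] with x hx
      gcongr
      rw [enorm_le_iff_norm_le]
      exact hx.trans (Real.le_norm_self _)
    · exact ((eLpNorm_lt_top_iff_lintegral_rpow_enorm_lt_top two_ne_zero
        ENNReal.ofNat_ne_top).1 hg.2).ne
    · filter_upwards [hl] with x hx
      have h1 : Filter.Tendsto (fun i => ‖F i x - f x‖ₑ) l (𝓝 ‖f x - f x‖ₑ) :=
        (hx.sub_const _).enorm
      have h2 := (ENNReal.continuous_rpow_const (y := (2 : ℝ≥0∞).toReal)).tendsto ‖f x - f x‖ₑ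
      have h3 := h2.comp h1
      simpa [Function.comp_def] using h3
  have h4 := (ENNReal.continuous_rpow_const (y := 1 / (2 : ℝ≥0∞).toReal)).tendsto
    (∫⁻ _ : ℝ, 0)
  have h5 := h4.comp key
  simpa [Function.comp_def] using h5

/-! ### The free Laplacian as a Fourier multiplier -/

/-- The Fourier transform on `L²(ℝ)`. -/
def FT : L2 ≃ₗᵢ[ℂ] L2 := Lp.fourierTransformₗᵢ ℝ ℂ

/-- The symbol `(2πξ)²` of `-d²/dx²`. -/
def symb (ξ : ℝ) : ℝ := (2 * Real.pi * ξ) ^ 2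

theorem measurable_symb : Measurable symb := by unfold symb; fun_prop

theorem symb_nonneg (ξ : ℝ) : 0 ≤ symb ξ := sq_nonneg _

theorem measurable_symbC : Measurable fun ξ => (symb ξ : ℂ) :=
  Complex.measurable_ofReal.comp measurable_symb

theorem FT_add_coeFn (f g : L2) : FT (f + g) =ᵐ[volume] fun ξ => FT f ξ + FT g ξ := by
  rw [map_add]
  exact Lp.coeFn_add (FT f) (FT g)

theorem FT_smul_coeFn (c : ℂ) (f : L2) : FT (c • f) =ᵐ[volume] fun ξ => c * FT f ξ := by
  rw [map_smul]
  exact Lp.coeFn_smul c (FT f)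

/-- The maximal domain of the Fourier multiplier with symbol `symb`. -/
def freeDomain : Submodule ℂ L2 where
  carrier := {f | MemLp (fun ξ => (symb ξ : ℂ) * FT f ξ) 2 (volume : Measure ℝ)}
  zero_mem' := by
    refine (memLp_congr_ae ?_).2 (MemLp.zero (ε := ℂ))
    rw [map_zero]
    filter_upwards [Lp.coeFn_zero ℂ 2 (volume : Measure ℝ)] with ξ h
    rw [h, Pi.zero_apply, mul_zero]
  add_mem' {f g} hf hg := by
    refine (memLp_congr_ae ?_).2 (hf.add hg)
    filter_upwards [FT_add_coeFn f g] with ξ h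
    rw [h, mul_add, Pi.add_apply]
  smul_mem' c f hf := by
    refine (memLp_congr_ae ?_).2 (hf.const_smul c)
    filter_upwards [FT_smul_coeFn c f] with ξ h
    rw [h, Pi.smul_apply, smul_eq_mul]
    ring

theorem mem_freeDomain {f : L2} :
    f ∈ freeDomain ↔ MemLp (fun ξ => (symb ξ : ℂ) * FT f ξ) 2 (volume : Measure ℝ) :=
  Iff.rfl

/-- Multiplication by the symbol on the Fourier side. -/
def symbMul : freeDomain →ₗ[ℂ] L2 where
  toFun f := MemLp.toLp _ (mem_freeDomain.1 f.2)
  map_add' f g := by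
    rw [← MemLp.toLp_add, MemLp.toLp_eq_toLp_iff]
    filter_upwards [FT_add_coeFn f g] with ξ h
    rw [Submodule.coe_add, h, mul_add, Pi.add_apply]
  map_smul' c f := by
    rw [RingHom.id_apply, ← MemLp.toLp_const_smul, MemLp.toLp_eq_toLp_iff]
    filter_upwards [FT_smul_coeFn c f] with ξ h
    rw [Submodule.coe_smul, h, Pi.smul_apply, smul_eq_mul]
    ring

/-- The self-adjoint realization of `-d²/dx²`, with its maximal domain. -/
def freeL : L2 →ₗ.[ℂ] L2 where
  domain := freeDomain
  toFun := FT.symm.toLinearEquiv.toLinearMap ∘ₗ symbMul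

theorem FT_freeL (f : freeL.domain) :
    FT (freeL f) =ᵐ[volume] fun ξ => (symb ξ : ℂ) * FT (f : L2) ξ := by
  have : FT (freeL f) = symbMul f := FT.apply_symm_apply _
  rw [this]
  exact MemLp.coeFn_toLp (mem_freeDomain.1 f.2)

/-- Domain membership comes for free: `FT g` is already square integrable, hence so is the product
it agrees with. -/
theorem freeL_of_ae {f g : L2} (h : FT g =ᵐ[volume] fun ξ => (symb ξ : ℂ) * FT f ξ) :
    ∃ hf : f ∈ freeL.domain, freeL ⟨f, hf⟩ = g := by
  have hf : f ∈ freeL.domain := mem_freeDomain.2 ((memLp_congr_ae h).1 (Lp.memLp _))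
  refine ⟨hf, FT.injective (Lp.ext ?_)⟩
  exact (FT_freeL ⟨f, hf⟩).trans h.symm

theorem mem_freeL_graph {p : L2 × L2} :
    p ∈ freeL.graph ↔ FT p.2 =ᵐ[volume] fun ξ => (symb ξ : ℂ) * FT p.1 ξ := by
  rw [LinearPMap.mem_graph_iff]
  constructor
  · rintro ⟨y, h1, h2⟩
    rw [← h1, ← h2]
    exact FT_freeL y
  · intro h
    obtain ⟨hf, hg⟩ := freeL_of_ae h
    exact ⟨⟨p.1, hf⟩, rfl, hg⟩

/-- If `r (symb - z) = 1` with `r` bounded, then the multiplier `r` inverts `L - z`. -/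
theorem freeL_resolvent {z : ℂ} {r : ℝ → ℂ} (hr : Measurable r) {C : ℝ} (hC : ∀ ξ, ‖r ξ‖ ≤ C)
    (h : ∀ ξ, r ξ * ((symb ξ : ℂ) - z) = 1) :
    (∀ y : L2, ∃ x : freeL.domain, (x : L2) = FT.symm (mulOp r (FT y)) ∧
      freeL x - z • (x : L2) = y) ∧
    ∀ x : freeL.domain, FT.symm (mulOp r (FT (freeL x - z • (x : L2)))) = x := by
  constructor
  · intro y
    -- With `x` the candidate preimage, `L x = y + z x` has to hold; on the Fourier side this is `1
    -- + z r = symb · r`.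
    have h1 : FT (y + z • FT.symm (mulOp r (FT y))) =ᵐ[volume]
        fun ξ => (symb ξ : ℂ) * FT (FT.symm (mulOp r (FT y))) ξ := by
      rw [map_add, map_smul, LinearIsometryEquiv.apply_symm_apply]
      filter_upwards [Lp.coeFn_add (FT y) (z • mulOp r (FT y)), Lp.coeFn_smul z (mulOp r (FT y)),
        mulOp_coeFn hr hC (FT y)] with ξ h1 h2 h3
      rw [h1, Pi.add_apply, h2, Pi.smul_apply, h3, smul_eq_mul]
      linear_combination (-FT y ξ) * h ξ
    obtain ⟨hx, hxe⟩ := freeL_of_ae h1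
    exact ⟨⟨_, hx⟩, rfl, by rw [hxe]; simp⟩
  · intro x
    rw [LinearIsometryEquiv.symm_apply_eq]
    refine Lp.ext ?_
    refine (mulOp_coeFn hr hC _).trans ?_
    rw [map_sub, map_smul]
    filter_upwards [Lp.coeFn_sub (FT (freeL x)) (z • FT (x : L2)), Lp.coeFn_smul z (FT (x : L2)),
        FT_freeL x] with ξ h1 h2 h3
    rw [h1, Pi.sub_apply, h2, Pi.smul_apply, h3, smul_eq_mul]
    linear_combination (FT (x : L2) ξ) * h ξ

theorem measurable_resolvent_symbol (z : ℂ) : Measurable fun ξ => ((symb ξ : ℂ) - z)⁻¹ :=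
  (measurable_symbC.sub_const z).inv

/-- A positive distance `δ` from `z` to the values of the symbol bounds the multiplier `(symb -
z)⁻¹` by `δ⁻¹`. -/
theorem mem_resolventSet_freeL {z : ℂ} {δ : ℝ} (hδ : 0 < δ) (h : ∀ ξ, δ ≤ ‖(symb ξ : ℂ) - z‖) :
    z ∈ resolventSet freeL := by
  have hr := freeL_resolvent (z := z) (measurable_resolvent_symbol z) (C := δ⁻¹)
    (fun ξ => by rw [norm_inv]; gcongr; exact h ξ)
    (fun ξ => inv_mul_cancel₀ (norm_pos_iff.1 (hδ.trans_le (h ξ))))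
  exact ⟨FT.symm.toContinuousLinearEquiv.toContinuousLinearMap ∘L mulOp _ ∘L
    FT.toContinuousLinearEquiv.toContinuousLinearMap, hr.1, hr.2⟩

theorem freeL_symmetric (x y : freeL.domain) :
    inner ℂ (freeL x) (y : L2) = inner ℂ (x : L2) (freeL y) := by
  rw [← FT.inner_map_map (freeL x), ← FT.inner_map_map (x : L2), L2.inner_def, L2.inner_def]
  refine integral_congr_ae ?_
  filter_upwards [FT_freeL x, FT_freeL y] with ξ h1 h2
  rw [h1, h2]
  simp only [RCLike.inner_apply, map_mul, Complex.conj_ofReal]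
  ring

/-! ### Self-adjointness -/

/-- A densely defined symmetric operator `T` with `T - i` and `T + i` surjective is self-adjoint. -/
theorem isSelfAdjoint_of_symmetric_of_surjective {H : Type*} [NormedAddCommGroup H]
    [InnerProductSpace ℂ H] [CompleteSpace H] {T : H →ₗ.[ℂ] H} (hd : Dense (T.domain : Set H))
    (hs : ∀ x y : T.domain, inner ℂ (T x) (y : H) = inner ℂ (x : H) (T y))
    (h1 : ∀ y, ∃ x : T.domain, T x - Complex.I • (x : H) = y)
    (h2 : ∀ y, ∃ x : T.domain, T x - (-Complex.I) • (x : H) = y) : IsSelfAdjoint T := by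
  have hle : T ≤ T.adjoint := LinearPMap.IsFormalAdjoint.le_adjoint hd (fun x y => hs x y)
  rw [LinearPMap.isSelfAdjoint_def]
  refine (LinearPMap.eq_of_le_of_domain_eq hle (le_antisymm hle.1 ?_)).symm
  intro f hf
  -- Choose `h` in the domain with `(T - i)h = (T* - i)f`, then `k` with `(T + i)k = f - h`. Moving
  -- `T + i` across the inner product gives `⟨f - h, f - h⟩ = ⟨(T* - i)f - (T - i)h, k⟩ = 0`.
  obtain ⟨h, hh⟩ := h1 (T.adjoint ⟨f, hf⟩ - Complex.I • f)
  suffices f = h by rw [this]; exact h.2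
  obtain ⟨k, hk⟩ := h2 (f - h)
  have e1 : inner ℂ (T.adjoint ⟨f, hf⟩) (k : H) = inner ℂ f (T k) :=
    LinearPMap.adjoint_isFormalAdjoint hd ⟨f, hf⟩ k
  have e2 := hs h k
  have e3 : inner ℂ (f - (h : H)) (f - (h : H)) = 0 := by
    nth_rewrite 2 [← hk]
    have e4 := congrArg (fun v => inner ℂ v (k : H)) hh
    simp only [inner_sub_left, inner_smul_left, Complex.conj_I] at e4
    simp only [inner_sub_left, inner_sub_right, inner_smul_right]
    linear_combination e2 - e1 - e4
  exact sub_eq_zero.1 (inner_self_eq_zero.1 e3)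

theorem freeL_sub_surjective {z : ℂ} {δ : ℝ} (hδ : 0 < δ) (h : ∀ ξ, δ ≤ ‖(symb ξ : ℂ) - z‖)
    (y : L2) : ∃ x : freeL.domain, freeL x - z • (x : L2) = y := by
  obtain ⟨R, hR, -⟩ := mem_resolventSet_freeL hδ h
  obtain ⟨x, -, hx⟩ := hR y
  exact ⟨x, hx⟩

theorem freeL_isSelfAdjoint (hd : Dense (freeL.domain : Set L2)) : IsSelfAdjoint freeL := by
  refine isSelfAdjoint_of_symmetric_of_surjective hd freeL_symmetric
    (freeL_sub_surjective one_pos fun ξ => ?_) (freeL_sub_surjective one_pos fun ξ => ?_)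
  -- The symbol is real, so the imaginary part alone has absolute value `1`.
  · simpa using Complex.abs_im_le_norm ((symb ξ : ℂ) - Complex.I)
  · simpa using Complex.abs_im_le_norm ((symb ξ : ℂ) - -Complex.I)

/-! ### The spectrum -/

theorem opSpectrum_freeL_subset : opSpectrum freeL ⊆ Complex.ofReal '' Ici 0 := by
  intro z hz
  by_contra hn
  refine hz ?_
  have hcl : IsClosed (Complex.ofReal '' Ici (0 : ℝ)) :=
    Complex.isometry_ofReal.isClosedEmbedding.isClosedMap _ isClosed_Ici
  obtain ⟨δ, hδ, h⟩ := Metric.isOpen_iff.1 hcl.isOpen_compl z hn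
  refine mem_resolventSet_freeL hδ fun ξ => ?_
  by_contra! hlt
  exact h (mem_ball_iff_norm.2 hlt) ⟨symb ξ, symb_nonneg ξ, rfl⟩

/-- Approximate eigenvectors: if `g` is the indicator of a set of frequencies where `symb` is within
`ε` of `t`, then `‖(L - t) FT⁻¹g‖ ≤ ε ‖g‖`. A bounded inverse `R` would force `1 ≤ ‖R‖ ε`. -/
theorem subset_opSpectrum_freeL : Complex.ofReal '' Ici 0 ⊆ opSpectrum freeL := by
  rintro _ ⟨t, ht, rfl⟩ ⟨R, -, hR⟩
  -- This makes `‖R‖ ε < 1`; the added `1` covers `R = 0`.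
  set ε : ℝ := (‖R‖ + 1)⁻¹ / 2 with hε
  have hR0 : 0 < ‖R‖ + 1 := by positivity
  have hε0 : 0 < ε := by positivity
  have hcont : Continuous symb := by unfold symb; fun_prop
  set ξ₀ : ℝ := Real.sqrt t / (2 * Real.pi) with hξ₀
  have hs0 : symb ξ₀ = t := by
    rw [symb, hξ₀, mul_div_cancel₀ _ (by positivity), Real.sq_sqrt ht]
  -- Intersecting with a bounded interval gives finite measure at once; openness around `ξ₀` gives
  -- positive measure.
  set s : Set ℝ := symb ⁻¹' Ioo (t - ε) (t + ε) ∩ Ioo (ξ₀ - 1) (ξ₀ + 1) with hs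
  have hso : IsOpen s := (isOpen_Ioo.preimage hcont).inter isOpen_Ioo
  have hξs : ξ₀ ∈ s := by
    refine ⟨?_, ?_⟩
    · simp only [mem_preimage, hs0, mem_Ioo]; constructor <;> linarith
    · constructor <;> linarith
  have hvol : volume s ≠ 0 := (hso.measure_pos volume ⟨ξ₀, hξs⟩).ne'
  have hfin : volume s ≠ ⊤ :=
    ((measure_mono inter_subset_right).trans_lt (by simp)).ne
  have hms : MeasurableSet s := hso.measurableSet
  set g : L2 := indicatorConstLp 2 hms hfin (1 : ℂ) with hg
  have hgc : g =ᵐ[volume] s.indicator fun _ => (1 : ℂ) := indicatorConstLp_coeFn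
  have hbd : ∀ ξ, ‖(s.indicator fun ξ => (symb ξ : ℂ)) ξ‖ ≤ t + ε := by
    intro ξ
    by_cases h : ξ ∈ s
    · rw [indicator_of_mem h, Complex.norm_real, Real.norm_of_nonneg (symb_nonneg ξ)]
      exact h.1.2.le
    · rw [indicator_of_notMem h, norm_zero]
      exact add_nonneg ht hε0.le
  have hx : FT (FT.symm (mulOp (s.indicator fun ξ => (symb ξ : ℂ)) g)) =ᵐ[volume]
      fun ξ => (symb ξ : ℂ) * FT (FT.symm g) ξ := by
    rw [FT.apply_symm_apply, FT.apply_symm_apply]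
    filter_upwards [mulOp_coeFn (measurable_symbC.indicator hms) hbd g, hgc] with ξ h1 h2
    rw [h1, h2]
    by_cases h : ξ ∈ s <;> simp [h]
  obtain ⟨hd, he⟩ := freeL_of_ae hx
  have h1 := hR ⟨_, hd⟩
  have hnorm : ‖freeL ⟨_, hd⟩ - (t : ℂ) • FT.symm g‖ ≤ ε * ‖g‖ := by
    rw [he, ← map_smul, ← map_sub, LinearIsometryEquiv.norm_map]
    refine Lp.norm_le_mul_norm_of_ae_le_mul ?_
    filter_upwards [mulOp_coeFn (measurable_symbC.indicator hms) hbd g, hgc,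
      Lp.coeFn_sub (mulOp (s.indicator fun ξ => (symb ξ : ℂ)) g) ((t : ℂ) • g),
      Lp.coeFn_smul (t : ℂ) g] with ξ h1 h2 h3 h4
    rw [h3, Pi.sub_apply, h1, h4, Pi.smul_apply, h2]
    by_cases h : ξ ∈ s
    · simp only [h, indicator_of_mem, mul_one, smul_eq_mul, norm_one]
      rw [← Complex.ofReal_sub, Complex.norm_real, Real.norm_eq_abs, abs_le]
      constructor <;> linarith [h.1.1, h.1.2]
    · simp [h]
  have hgn : 0 < ‖g‖ := by
    rw [hg, norm_indicatorConstLp two_ne_zero ENNReal.ofNat_ne_top]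
    have : 0 < volume.real s := ENNReal.toReal_pos hvol hfin
    simp only [norm_one, one_mul]
    positivity
  have h2 : ‖g‖ ≤ ‖R‖ * (ε * ‖g‖) := by
    calc ‖g‖ = ‖R (freeL ⟨_, hd⟩ - (t : ℂ) • FT.symm g)‖ := by rw [h1]; simp
      _ ≤ ‖R‖ * ‖freeL ⟨_, hd⟩ - (t : ℂ) • FT.symm g‖ := R.le_opNorm _
      _ ≤ _ := by gcongr
  have h3 : ‖R‖ * ε < 1 := by
    calc ‖R‖ * ε ≤ (‖R‖ + 1) * ε := by gcongr; linarith
      _ = 1 / 2 := by rw [hε]; field_simp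
      _ < 1 := by norm_num
  nlinarith

theorem opSpectrum_freeL : opSpectrum freeL = Complex.ofReal '' Ici 0 :=
  opSpectrum_freeL_subset.antisymm subset_opSpectrum_freeL

/-- The part of an operator in the whole space has the same spectrum. -/
theorem opSpectrum_part_top {H : Type*} [NormedAddCommGroup H] [NormedSpace ℂ H]
    (T : H →ₗ.[ℂ] H) : opSpectrum (part T ⊤) = opSpectrum T := by
  refine congrArg compl (Set.ext fun z => ?_)
  constructor
  · rintro ⟨R, h1, h2⟩
    refine ⟨(⊤ : Submodule ℂ H).subtypeL ∘L R ∘L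
      (ContinuousLinearMap.id ℂ H).codRestrict ⊤ (fun _ => trivial), fun y => ?_, fun x => ?_⟩
    · obtain ⟨x, hx, hy⟩ := h1 ⟨y, trivial⟩
      exact ⟨⟨_, x.2.1⟩, congrArg Subtype.val hx, congrArg Subtype.val hy⟩
    · exact congrArg Subtype.val (h2 ⟨⟨x, trivial⟩, x.2, trivial⟩)
  · rintro ⟨R, h1, h2⟩
    refine ⟨(ContinuousLinearMap.id ℂ H).codRestrict ⊤ (fun _ => trivial) ∘L R ∘L
      (⊤ : Submodule ℂ H).subtypeL, fun y => ?_, fun x => ?_⟩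
    · obtain ⟨x, hx, hy⟩ := h1 y
      exact ⟨⟨⟨x, trivial⟩, x.2, trivial⟩, Subtype.ext hx, Subtype.ext hy⟩
    · exact Subtype.ext (h2 ⟨_, x.2.1⟩)

/-! ### Essential self-adjointness -/

theorem schwartz_coeFn (ψ : 𝓢(ℝ, ℂ)) : (ψ.toLp 2 (volume : Measure ℝ) : L2) =ᵐ[volume] ψ :=
  ψ.coeFn_toLp 2 volume

theorem FT_schwartz (ψ : 𝓢(ℝ, ℂ)) :
    FT (ψ.toLp 2 (volume : Measure ℝ)) = (𝓕 ψ).toLp 2 (volume : Measure ℝ) :=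
  ψ.toLp_fourier_eq

theorem fourier_derivCLM (ψ : 𝓢(ℝ, ℂ)) (ξ : ℝ) :
    𝓕 (SchwartzMap.derivCLM ℂ ℂ ψ) ξ = (2 * Real.pi * Complex.I * ξ) * 𝓕 ψ ξ := by
  have h := Real.fourier_deriv (f := ψ) ψ.integrable ψ.differentiable
    (SchwartzMap.derivCLM ℂ ℂ ψ).integrable
  exact congrFun h ξ

/-- The second derivative of a Schwartz function. -/
def secondDeriv (ψ : 𝓢(ℝ, ℂ)) : 𝓢(ℝ, ℂ) :=
  SchwartzMap.derivCLM ℂ ℂ (SchwartzMap.derivCLM ℂ ℂ ψ)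

/-- Two derivatives multiply the Fourier transform by `(2πiξ)²`, which is `-symb ξ`. -/
theorem schwartz_mem_freeL_graph (ψ : 𝓢(ℝ, ℂ)) :
    ((ψ.toLp 2 volume : L2), -((secondDeriv ψ).toLp 2 volume : L2)) ∈ freeL.graph := by
  rw [mem_freeL_graph]
  simp only [map_neg, FT_schwartz]
  filter_upwards [Lp.coeFn_neg ((𝓕 (secondDeriv ψ)).toLp 2 (volume : Measure ℝ)),
    schwartz_coeFn (𝓕 ψ), schwartz_coeFn (𝓕 (secondDeriv ψ))] with ξ h1 h2 h3
  rw [h1, Pi.neg_apply, h3, h2, secondDeriv, fourier_derivCLM, fourier_derivCLM, symb]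
  push_cast
  linear_combination (-(2 * Real.pi * ξ : ℂ) ^ 2 * 𝓕 ψ ξ) * Complex.I_sq

/-- A test function as a Schwartz function. -/
def testToSchwartz (φ : testFunctions) : 𝓢(ℝ, ℂ) := φ.2.2.toSchwartzMap φ.2.1

theorem testToL2_eq (φ : testFunctions) : testToL2 φ = (testToSchwartz φ).toLp 2 volume := rfl

theorem testToL2_coeFn (φ : testFunctions) : testToL2 φ =ᵐ[volume] (φ : ℝ → ℂ) :=
  MemLp.coeFn_toLp (testFunctions_memLp φ)

theorem testToL2_negSecondDeriv (φ : testFunctions) :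
    testToL2 (negSecondDeriv φ) = -((secondDeriv (testToSchwartz φ)).toLp 2 volume : L2) := by
  refine Lp.ext ?_
  filter_upwards [testToL2_coeFn (negSecondDeriv φ), schwartz_coeFn (secondDeriv (testToSchwartz φ)),
    Lp.coeFn_neg ((secondDeriv (testToSchwartz φ)).toLp 2 (volume : Measure ℝ))] with x h1 h2 h3
  rw [h1, h3, Pi.neg_apply, h2]
  rfl

theorem mem_minimalOperator_graph {p : L2 × L2} : p ∈ minimalOperator.graph ↔
    ∃ φ : testFunctions, testToL2 φ = p.1 ∧ testToL2 (negSecondDeriv φ) = p.2 := by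
  rw [LinearPMap.mem_graph_iff]
  constructor
  · rintro ⟨⟨_, φ, rfl⟩, h1, h2⟩
    exact ⟨φ, h1, (minimalOperator_apply φ).symm.trans h2⟩
  · rintro ⟨φ, h1, h2⟩
    exact ⟨⟨testToL2 φ, LinearMap.mem_range_self _ φ⟩, h1, (minimalOperator_apply φ).trans h2⟩

theorem minimalOperator_le_freeL : minimalOperator ≤ freeL := by
  refine LinearPMap.le_of_le_graph fun p hp => ?_
  obtain ⟨φ, h1, h2⟩ := mem_minimalOperator_graph.1 hp
  have := schwartz_mem_freeL_graph (testToSchwartz φ)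
  rwa [← testToL2_eq, ← testToL2_negSecondDeriv, h1, h2] at this

theorem dense_range_testToL2 : Dense (range testToL2) := by
  refine (Lp.dense_hasCompactSupport_contDiff (F := ℂ) (μ := (volume : Measure ℝ)) (p := 2)
    ENNReal.ofNat_ne_top).mono ?_
  rintro f ⟨g, hfg, hg1, hg2⟩
  exact ⟨⟨g, hg2, hg1⟩, Lp.ext ((testToL2_coeFn _).trans hfg.symm)⟩

theorem dense_minimalOperator_domain : Dense (minimalOperator.domain : Set L2) :=
  dense_range_testToL2

theorem freeL_selfAdjoint : IsSelfAdjoint freeL :=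
  freeL_isSelfAdjoint (dense_minimalOperator_domain.mono minimalOperator_le_freeL.1)

theorem minimalOperator_isClosable : minimalOperator.IsClosable :=
  freeL_selfAdjoint.isClosed.isClosable.leIsClosable minimalOperator_le_freeL

theorem exists_cutoff : ∃ η : testFunctions, (η : ℝ → ℂ) 0 = 1 := by
  let b : ContDiffBump (0 : ℝ) := ⟨1, 2, one_pos, one_lt_two⟩
  refine ⟨⟨fun x => (b x : ℂ), ?_, ?_⟩, ?_⟩
  · exact Complex.ofRealCLM.contDiff.comp b.contDiff
  · exact b.hasCompactSupport.comp_left Complex.ofReal_zero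
  · simp [b.one_of_mem_closedBall (Metric.mem_closedBall_self b.rIn_pos.le)]

theorem testFunctions_bounded (φ : testFunctions) : ∃ C, ∀ x, ‖(φ : ℝ → ℂ) x‖ ≤ C :=
  φ.2.2.exists_bound_of_continuous φ.2.1.continuous

theorem testFunctions_hasDerivAt (φ : testFunctions) (x : ℝ) :
    HasDerivAt (φ : ℝ → ℂ) (deriv φ x) x :=
  ((φ.2.1.differentiable (by simp)) x).hasDerivAt

/-- The product of a Schwartz function with a dilated test function. -/
def cutoff (ψ : 𝓢(ℝ, ℂ)) (η : testFunctions) {ε : ℝ} (hε : ε ≠ 0) : testFunctions :=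
  ⟨fun x => ψ x * (η : ℝ → ℂ) (ε * x),
    ψ.smooth'.mul (η.2.1.comp (contDiff_const.mul contDiff_id)),
    (η.2.2.comp_homeomorph (Homeomorph.mulLeft₀ ε hε)).mul_left⟩

theorem deriv_mul_dilation {f g f' g' : ℝ → ℂ} (hf : ∀ x, HasDerivAt f (f' x) x)
    (hg : ∀ x, HasDerivAt g (g' x) x) (ε : ℝ) (x : ℝ) :
    HasDerivAt (fun x => f x * g (ε * x)) (f' x * g (ε * x) + ε * (f x * g' (ε * x))) x := by
  have h1 : HasDerivAt (fun x => g (ε * x)) ((ε * 1 : ℝ) • g' (ε * x)) x :=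
    (hg (ε * x)).scomp x ((hasDerivAt_id x).const_mul ε)
  have h2 := (hf x).mul h1
  refine h2.congr_deriv ?_
  rw [mul_one, Complex.real_smul]
  ring

/-- By the Leibniz rule each derivative falling on the dilated cutoff costs a factor `ε`, so only
the first term survives as `ε → 0`. -/
theorem negSecondDeriv_cutoff (ψ : 𝓢(ℝ, ℂ)) (η : testFunctions) {ε : ℝ} (hε : ε ≠ 0) (x : ℝ) :
    (negSecondDeriv (cutoff ψ η hε) : ℝ → ℂ) x =
      -(secondDeriv ψ x * (η : ℝ → ℂ) (ε * x)
        + 2 * ε * (deriv ψ x * deriv (η : ℝ → ℂ) (ε * x))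
        + ε ^ 2 * (ψ x * deriv (deriv (η : ℝ → ℂ)) (ε * x))) := by
  have hψ : ∀ x, HasDerivAt ψ (deriv ψ x) x := fun x => ψ.differentiable.differentiableAt.hasDerivAt
  have hψ' : ∀ x, HasDerivAt (deriv ψ) (secondDeriv ψ x) x := fun x =>
    (SchwartzMap.derivCLM ℂ ℂ ψ).differentiable.differentiableAt.hasDerivAt
  have hη := testFunctions_hasDerivAt η
  have hη' : ∀ x, HasDerivAt (deriv (η : ℝ → ℂ)) (deriv (deriv (η : ℝ → ℂ)) x) x :=
    testFunctions_hasDerivAt ⟨_, testFunctions_deriv η.2⟩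
  have h1 : deriv (cutoff ψ η hε : ℝ → ℂ) =
      fun x => deriv ψ x * (η : ℝ → ℂ) (ε * x) + ε * (ψ x * deriv (η : ℝ → ℂ) (ε * x)) :=
    funext fun x => (deriv_mul_dilation hψ hη ε x).deriv
  change -deriv (deriv (cutoff ψ η hε : ℝ → ℂ)) x = _
  have h2 := (deriv_mul_dilation hψ' hη ε x).add
    ((deriv_mul_dilation hψ hη' ε x).const_mul (ε : ℂ))
  rw [h1]
  refine (congrArg Neg.neg h2.deriv).trans ?_
  ring

theorem tendsto_cutoff_apply {φ : ℝ → ℂ} (hφ : Continuous φ) (x : ℝ) :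
    Filter.Tendsto (fun n : ℕ => φ ((1 / (n + 1) : ℝ) * x)) Filter.atTop (𝓝 (φ 0)) := by
  refine (hφ.tendsto 0).comp ?_
  simpa using tendsto_one_div_add_atTop_nhds_zero_nat.mul_const x

/-- Schwartz functions belong to the domain of the closure of the minimal operator. -/
theorem schwartz_mem_closure (ψ : 𝓢(ℝ, ℂ)) :
    ((ψ.toLp 2 volume : L2), -((secondDeriv ψ).toLp 2 volume : L2)) ∈
      closure (minimalOperator.graph : Set (L2 × L2)) := by
  obtain ⟨η, hη⟩ := exists_cutoff
  obtain ⟨C₀, hC₀⟩ := testFunctions_bounded η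
  obtain ⟨C₁, hC₁⟩ := testFunctions_bounded ⟨_, testFunctions_deriv η.2⟩
  obtain ⟨C₂, hC₂⟩ := testFunctions_bounded ⟨_, testFunctions_deriv (testFunctions_deriv η.2)⟩
  have hε : ∀ n : ℕ, (1 / (n + 1) : ℝ) ≠ 0 := fun n => by positivity
  have hε1 : ∀ n : ℕ, ‖((1 / (n + 1) : ℝ) : ℂ)‖ ≤ 1 := fun n => by
    rw [Complex.norm_real, Real.norm_of_nonneg (by positivity), div_le_one (by positivity)]
    linarith [n.cast_nonneg (α := ℝ)]
  have hεl : Filter.Tendsto (fun n : ℕ => ((1 / (n + 1) : ℝ) : ℂ)) Filter.atTop (𝓝 0) := by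
    have := (Complex.continuous_ofReal.tendsto 0).comp
      (tendsto_one_div_add_atTop_nhds_zero_nat (𝕜 := ℝ))
    simpa only [Complex.ofReal_zero, Function.comp_def] using this
  have hψ0 : MemLp ψ 2 (volume : Measure ℝ) := ψ.memLp 2 volume
  have hψ1 : MemLp (deriv ψ) 2 (volume : Measure ℝ) := (SchwartzMap.derivCLM ℂ ℂ ψ).memLp 2 volume
  have hψ2 : MemLp (secondDeriv ψ) 2 (volume : Measure ℝ) := (secondDeriv ψ).memLp 2 volume
  -- The dilation parameter is `1/(n+1)`. It is at most `1`, so the dominating functions below can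
  -- be chosen independent of `n`.
  refine mem_closure_of_tendsto (b := Filter.atTop)
    (f := fun n : ℕ => (testToL2 (cutoff ψ η (hε n)),
      testToL2 (negSecondDeriv (cutoff ψ η (hε n))))) ?_
    (Filter.Eventually.of_forall fun n => mem_minimalOperator_graph.2 ⟨_, rfl, rfl⟩)
  rw [Prod.tendsto_iff]
  constructor
  · refine tendsto_L2_of_dominated (g := fun x => C₀ * ‖ψ x‖ + ‖ψ x‖)
      ((hψ0.norm.const_mul C₀).add hψ0.norm) (fun n => ?_) ?_
    · filter_upwards [testToL2_coeFn (cutoff ψ η (hε n)), schwartz_coeFn ψ] with x h1 h2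
      rw [h1, h2]
      refine (norm_sub_le _ _).trans ?_
      gcongr
      change ‖ψ x * _‖ ≤ _
      rw [norm_mul, mul_comm]
      gcongr
      exact hC₀ _
    · filter_upwards [ae_all_iff.2 fun n => testToL2_coeFn (cutoff ψ η (hε n)),
        schwartz_coeFn ψ] with x h1 h2
      simp_rw [h1, h2]
      have := (tendsto_cutoff_apply η.2.1.continuous x).const_mul (ψ x)
      rwa [hη, mul_one] at this
  · refine tendsto_L2_of_dominated
      (g := fun x => C₀ * ‖secondDeriv ψ x‖ + 2 * C₁ * ‖deriv ψ x‖ + C₂ * ‖ψ x‖ +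
        ‖secondDeriv ψ x‖)
      ((((hψ2.norm.const_mul C₀).add (hψ1.norm.const_mul (2 * C₁))).add
        (hψ0.norm.const_mul C₂)).add hψ2.norm) (fun n => ?_) ?_
    · filter_upwards [testToL2_coeFn (negSecondDeriv (cutoff ψ η (hε n))),
        schwartz_coeFn (secondDeriv ψ),
        Lp.coeFn_neg ((secondDeriv ψ).toLp 2 (volume : Measure ℝ))] with x h1 h2 h3
      rw [h1, h3, Pi.neg_apply, h2, negSecondDeriv_cutoff]
      refine (norm_sub_le _ _).trans ?_
      rw [norm_neg, norm_neg]
      gcongr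
      refine (norm_add₃_le).trans ?_
      gcongr
      · rw [norm_mul, mul_comm]; gcongr; exact hC₀ _
      · rw [norm_mul, norm_mul, norm_mul, Complex.norm_ofNat]
        calc _ ≤ 2 * 1 * (‖deriv ψ x‖ * C₁) := by gcongr; exacts [hε1 n, hC₁ _]
          _ = _ := by ring
      · rw [norm_mul, norm_mul, norm_pow]
        calc _ ≤ 1 * (‖ψ x‖ * C₂) := by
              gcongr
              exacts [pow_le_one₀ (norm_nonneg _) (hε1 n), hC₂ _]
          _ = _ := by ring
    · filter_upwards [ae_all_iff.2 fun n =>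
          testToL2_coeFn (negSecondDeriv (cutoff ψ η (hε n))), schwartz_coeFn (secondDeriv ψ),
        Lp.coeFn_neg ((secondDeriv ψ).toLp 2 (volume : Measure ℝ))] with x h1 h2 h3
      simp_rw [h1, h3, Pi.neg_apply, h2, negSecondDeriv_cutoff]
      have t0 := (tendsto_cutoff_apply η.2.1.continuous x).const_mul (secondDeriv ψ x)
      have t1 := (hεl.const_mul 2).mul
        ((tendsto_cutoff_apply (testFunctions_deriv η.2).1.continuous x).const_mul (deriv ψ x))
      have t2 := (hεl.pow 2).mul ((tendsto_cutoff_apply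
        (testFunctions_deriv (testFunctions_deriv η.2)).1.continuous x).const_mul (ψ x))
      have t := ((t0.add t1).add t2).neg
      simpa only [hη, mul_one, mul_zero, zero_mul, add_zero, ne_eq, OfNat.ofNat_ne_zero,
        not_false_eq_true, zero_pow] using t

theorem one_add_symb_pos (ξ : ℝ) : 0 < 1 + symb ξ := by linarith [symb_nonneg ξ]

theorem one_add_symb_ne_zero (ξ : ℝ) : (1 + symb ξ : ℂ) ≠ 0 := by
  exact_mod_cast (one_add_symb_pos ξ).ne'

theorem norm_one_add_symb (ξ : ℝ) : ‖(1 + symb ξ : ℂ)‖ = 1 + symb ξ := by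
  rw [← Complex.ofReal_one, ← Complex.ofReal_add, Complex.norm_real,
    Real.norm_of_nonneg (one_add_symb_pos ξ).le]

/-- The regularizing parametrization of the graph of `L`. -/
def graphParam (h : L2) : L2 × L2 :=
  (FT.symm (mulOp (fun ξ => (1 + symb ξ : ℂ)⁻¹) h),
    FT.symm (mulOp (fun ξ => symb ξ / (1 + symb ξ : ℂ)) h))

theorem continuous_graphParam : Continuous graphParam :=
  (FT.symm.continuous.comp (mulOp _).continuous).prodMk
    (FT.symm.continuous.comp (mulOp _).continuous)

theorem mulOp_inv_coeFn (h : L2) : mulOp (fun ξ => (1 + symb ξ : ℂ)⁻¹) h =ᵐ[volume]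
    fun ξ => (1 + symb ξ : ℂ)⁻¹ * h ξ := by
  refine mulOp_coeFn (measurable_symbC.const_add 1).inv (C := 1) (fun ξ => ?_) h
  change ‖(1 + symb ξ : ℂ)⁻¹‖ ≤ 1
  rw [norm_inv, norm_one_add_symb]
  exact inv_le_one_of_one_le₀ (by linarith [symb_nonneg ξ])

theorem mulOp_div_coeFn (h : L2) : mulOp (fun ξ => symb ξ / (1 + symb ξ : ℂ)) h =ᵐ[volume]
    fun ξ => symb ξ / (1 + symb ξ : ℂ) * h ξ := by
  refine mulOp_coeFn (measurable_symbC.div (measurable_symbC.const_add 1)) (C := 1) (fun ξ => ?_) h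
  change ‖(symb ξ / (1 + symb ξ) : ℂ)‖ ≤ 1
  rw [norm_div, norm_one_add_symb, Complex.norm_real, Real.norm_of_nonneg (symb_nonneg ξ),
    div_le_one (one_add_symb_pos ξ)]
  linarith

theorem graphParam_mem_freeL_graph (h : L2) : graphParam h ∈ freeL.graph := by
  rw [mem_freeL_graph]
  simp only [graphParam, LinearIsometryEquiv.apply_symm_apply]
  filter_upwards [mulOp_inv_coeFn h, mulOp_div_coeFn h] with ξ h1 h2
  rw [h1, h2]
  ring

theorem freeL_graph_subset_range : (freeL.graph : Set (L2 × L2)) ⊆ range graphParam := by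
  rintro ⟨f, g⟩ hp
  have hp := mem_freeL_graph.1 hp
  -- On the graph this parameter is `(1 + symb) · FT f`; both multipliers of `graphParam` then
  -- return the right components.
  refine ⟨FT f + FT g, Prod.ext ?_ ?_⟩
  · refine (LinearIsometryEquiv.symm_apply_eq FT).2 (Lp.ext ?_)
    filter_upwards [mulOp_inv_coeFn (FT f + FT g), Lp.coeFn_add (FT f) (FT g), hp] with ξ h1 h2 h3
    rw [h1, h2, Pi.add_apply, h3]
    field_simp [one_add_symb_ne_zero ξ]
  · refine (LinearIsometryEquiv.symm_apply_eq FT).2 (Lp.ext ?_)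
    filter_upwards [mulOp_div_coeFn (FT f + FT g), Lp.coeFn_add (FT f) (FT g), hp] with ξ h1 h2 h3
    rw [h1, h2, Pi.add_apply, h3]
    field_simp [one_add_symb_ne_zero ξ]

/-- The parameter lives on the Fourier side. For a test function `χ`, the product `(1 + symb)⁻¹ χ`
is again smooth with compact support, so its inverse Fourier transform is Schwartz and
`schwartz_mem_closure` applies. -/
theorem graphParam_test_mem_closure (χ : testFunctions) :
    graphParam (testToL2 χ) ∈ closure (minimalOperator.graph : Set (L2 × L2)) := by
  have hsm : ContDiff ℝ ∞ fun ξ => (1 + symb ξ : ℂ)⁻¹ := by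
    refine ContDiff.inv ?_ one_add_symb_ne_zero
    refine contDiff_const.add (Complex.ofRealCLM.contDiff.comp ?_)
    exact (contDiff_const.mul contDiff_id).pow 2
  let ρ : testFunctions := ⟨fun ξ => (1 + symb ξ : ℂ)⁻¹ * (χ : ℝ → ℂ) ξ,
    hsm.mul χ.2.1, χ.2.2.mul_left⟩
  set ψ : 𝓢(ℝ, ℂ) := 𝓕⁻ (testToSchwartz ρ) with hψ
  have h1 : (graphParam (testToL2 χ)).1 = ψ.toLp 2 volume := by
    refine (LinearIsometryEquiv.symm_apply_eq FT).2 ?_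
    rw [FT_schwartz, hψ, FourierTransform.fourier_fourierInv_eq, ← testToL2_eq]
    refine Lp.ext ?_
    filter_upwards [mulOp_inv_coeFn (testToL2 χ), testToL2_coeFn χ, testToL2_coeFn ρ]
      with ξ h1 h2 h3
    rw [h1, h2, h3]
  have h2 : graphParam (testToL2 χ) =
      ((ψ.toLp 2 volume : L2), -((secondDeriv ψ).toLp 2 volume : L2)) := by
    refine Prod.ext h1 ?_
    -- Both pairs lie in the graph of `freeL`, so equal first components suffice.
    exact LinearPMap.mem_graph_snd_inj freeL (graphParam_mem_freeL_graph _)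
      (schwartz_mem_freeL_graph ψ) h1
  rw [h2]
  exact schwartz_mem_closure ψ

/-- One inclusion holds because a self-adjoint operator is closed. For the other, the graph of
`freeL` lies in the range of the continuous map `graphParam`, so membership in the closure need only
be checked on the dense set of test functions. -/
theorem closure_minimalOperator : minimalOperator.closure = freeL := by
  refine le_antisymm ?_ (LinearPMap.le_of_le_graph fun p hp => ?_)
  · have hc := freeL_selfAdjoint.isClosed
    refine LinearPMap.le_of_le_graph ?_
    rw [← minimalOperator_isClosable.graph_closure_eq_closure_graph]
    exact Submodule.topologicalClosure_minimal _
      (LinearPMap.le_graph_of_le minimalOperator_le_freeL) hc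
  · obtain ⟨h, rfl⟩ := freeL_graph_subset_range hp
    rw [← minimalOperator_isClosable.graph_closure_eq_closure_graph]
    have hcl : IsClosed {h | graphParam h ∈ closure (minimalOperator.graph : Set (L2 × L2))} :=
      isClosed_closure.preimage continuous_graphParam
    refine (hcl.closure_subset_iff (s := range testToL2)).2 ?_ (dense_range_testToL2 h)
    rintro _ ⟨χ, rfl⟩
    exact graphParam_test_mem_closure χ

theorem minimalOperator_isEssentiallySelfAdjoint : IsEssentiallySelfAdjoint minimalOperator :=
  ⟨minimalOperator_isClosable, closure_minimalOperator ▸ freeL_selfAdjoint⟩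

/-- The adjoint reverses inclusions of densely defined operators. -/
theorem adjoint_antitone {H : Type*} [NormedAddCommGroup H] [InnerProductSpace ℂ H]
    [CompleteSpace H] {S T : H →ₗ.[ℂ] H} (hS : Dense (S.domain : Set H))
    (hT : Dense (T.domain : Set H)) (h : S ≤ T) : T.adjoint ≤ S.adjoint := by
  refine LinearPMap.IsFormalAdjoint.le_adjoint hS fun x y => ?_
  have := LinearPMap.adjoint_isFormalAdjoint hT y ⟨x, h.1 x.2⟩
  rw [← h.2 (x := x) (y := ⟨x, h.1 x.2⟩) rfl] at this
  rw [← inner_conj_symm, ← this, inner_conj_symm]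

/-- A self-adjoint operator has no proper self-adjoint extension. -/
theorem selfAdjoint_eq_of_le {H : Type*} [NormedAddCommGroup H] [InnerProductSpace ℂ H]
    [CompleteSpace H] {S T : H →ₗ.[ℂ] H} (hS : IsSelfAdjoint S) (hT : IsSelfAdjoint T)
    (h : S ≤ T) : T = S := by
  have h1 := adjoint_antitone hS.dense_domain hT.dense_domain h
  rw [LinearPMap.isSelfAdjoint_def.1 hS, LinearPMap.isSelfAdjoint_def.1 hT] at h1
  exact le_antisymm h1 h

theorem eq_freeL_of_selfAdjoint_extension {T : L2 →ₗ.[ℂ] L2} (hT : IsSelfAdjoint T)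
    (h : minimalOperator ≤ T) : T = freeL := by
  refine selfAdjoint_eq_of_le freeL_selfAdjoint hT ?_
  rw [← closure_minimalOperator]
  refine LinearPMap.le_of_le_graph ?_
  rw [← minimalOperator_isClosable.graph_closure_eq_closure_graph]
  exact Submodule.topologicalClosure_minimal _ (LinearPMap.le_graph_of_le h) hT.isClosed

/-! ### The spectral resolution -/

theorem indOp_isStarProjection {s : Set ℝ} (hs : MeasurableSet s) : IsStarProjection (indOp s) := by
  refine ⟨ContinuousLinearMap.ext fun f => Lp.ext ?_,
    ContinuousLinearMap.isSelfAdjoint_iff_isSymmetric.2 fun f g => ?_⟩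
  · filter_upwards [indOp_coeFn hs (indOp s f), indOp_coeFn hs f] with x h1 h2
    rw [mul_apply_eq_comp, h1, h2]
    by_cases h : x ∈ s <;> simp [h, h2]
  · change inner ℂ (indOp s f) g = inner ℂ f (indOp s g)
    rw [L2.inner_def, L2.inner_def]
    refine integral_congr_ae ?_
    filter_upwards [indOp_coeFn hs f, indOp_coeFn hs g] with x h1 h2
    rw [h1, h2]
    by_cases h : x ∈ s <;> simp [h]

theorem indOp_univ : indOp univ = 1 := by
  refine ContinuousLinearMap.ext fun f => Lp.ext ?_
  filter_upwards [indOp_coeFn MeasurableSet.univ f] with x h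
  simpa using h

theorem sum_indOp_coeFn {s : ℕ → Set ℝ} (hs : ∀ n, MeasurableSet (s n)) (f : L2) (S : Finset ℕ) :
    (∑ n ∈ S, indOp (s n) f : L2) =ᵐ[volume] fun x => ∑ n ∈ S, (s n).indicator f x := by
  induction S using Finset.induction_on with
  | empty => simpa using! Lp.coeFn_zero ℂ 2 (volume : Measure ℝ)
  | insert n S hn ih =>
    simp_rw [Finset.sum_insert hn]
    filter_upwards [Lp.coeFn_add (indOp (s n) f) (∑ n ∈ S, indOp (s n) f), indOp_coeFn (hs n) f, ih]
      with x h1 h2 h3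
    rw [h1, Pi.add_apply, h2, h3]

/-- Disjointness makes each pointwise sum have at most one nonzero term, and makes a finite partial
sum the restriction of `f` to a subset of the union; the error is thus dominated by `|f|`. -/
theorem hasSum_indOp {s : ℕ → Set ℝ} (hs : ∀ n, MeasurableSet (s n))
    (hd : Pairwise fun m n => Disjoint (s m) (s n)) (f : L2) :
    HasSum (fun n => indOp (s n) f) (indOp (⋃ n, s n) f) := by
  have hpt : ∀ x, HasSum (fun n => (s n).indicator f x) ((⋃ n, s n).indicator f x) := by
    intro x
    by_cases hx : x ∈ ⋃ n, s n
    · obtain ⟨n, hn⟩ := mem_iUnion.1 hx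
      rw [indicator_of_mem hx, ← indicator_of_mem hn f]
      refine hasSum_single n fun m hm => indicator_of_notMem (fun hxm => ?_) _
      exact Set.disjoint_left.1 (hd hm) hxm hn
    · rw [indicator_of_notMem hx]
      have : (fun n => (s n).indicator f x) = fun _ => 0 := funext fun n =>
        indicator_of_notMem (fun h => hx (mem_iUnion.2 ⟨n, h⟩)) _
      rw [this]
      exact hasSum_zero
  refine tendsto_L2_of_dominated (g := fun x => ‖f x‖) (Lp.memLp f).norm (fun S => ?_) ?_
  · filter_upwards [sum_indOp_coeFn hs f S, indOp_coeFn (MeasurableSet.iUnion hs) f] with x h1 h2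
    rw [h1, h2, ← Finset.indicator_biUnion_apply S s (fun i _ j _ hij => hd hij)]
    by_cases hx : x ∈ ⋃ n ∈ S, s n
    · have hx' : x ∈ ⋃ n, s n := iUnion₂_subset (fun n _ => subset_iUnion s n) hx
      simp only [indicator_of_mem hx, indicator_of_mem hx', sub_self, norm_zero, norm_nonneg]
    · rw [indicator_of_notMem hx, zero_sub, norm_neg]
      exact norm_indicator_le_norm_self _ _
  · filter_upwards [ae_all_iff.2 fun S => sum_indOp_coeFn hs f S,
      indOp_coeFn (MeasurableSet.iUnion hs) f] with x h1 h2
    simp_rw [h1, h2]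
    exact hpt x

/-- The spectral projection of `L` on the set `s`. -/
def freeProj (s : Set ℝ) : L2 →L[ℂ] L2 :=
  FT.symm.toContinuousLinearEquiv.toContinuousLinearMap ∘L indOp (symb ⁻¹' s) ∘L
    FT.toContinuousLinearEquiv.toContinuousLinearMap

theorem freeProj_apply (s : Set ℝ) (f : L2) :
    freeProj s f = FT.symm (indOp (symb ⁻¹' s) (FT f)) := rfl

theorem inner_FT_symm_left (f g : L2) : inner ℂ (FT.symm f) g = inner ℂ f (FT g) := by
  rw [← FT.inner_map_map, FT.apply_symm_apply]

theorem inner_FT_symm_right (f g : L2) : inner ℂ f (FT.symm g) = inner ℂ (FT f) g := by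
  rw [← FT.inner_map_map, FT.apply_symm_apply]

/-- The spectral resolution of `L`. -/
def freePVM : ProjectionValuedMeasure L2 where
  proj := freeProj
  isStarProjection s hs := by
    have h := indOp_isStarProjection (measurable_symb hs)
    refine ⟨ContinuousLinearMap.ext fun f => ?_,
      ContinuousLinearMap.isSelfAdjoint_iff_isSymmetric.2 fun f g => ?_⟩
    · rw [mul_apply_eq_comp, freeProj_apply, freeProj_apply, FT.apply_symm_apply]
      exact congrArg FT.symm (congrArg (fun A : L2 →L[ℂ] L2 => A (FT f)) h.isIdempotentElem)
    · change inner ℂ (freeProj s f) g = inner ℂ f (freeProj s g)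
      rw [freeProj_apply, freeProj_apply, inner_FT_symm_left, inner_FT_symm_right]
      exact h.isSelfAdjoint.isSymmetric (FT f) (FT g)
  proj_univ := by
    refine ContinuousLinearMap.ext fun f => ?_
    rw [freeProj_apply, preimage_univ, indOp_univ]
    exact FT.symm_apply_apply f
  hasSum_iUnion s hs hd f := by
    have := hasSum_indOp (fun n => measurable_symb (hs n))
      (fun m n h => (hd h).preimage symb) (FT f)
    rw [← preimage_iUnion] at this
    exact this.mapL FT.symm.toContinuousLinearEquiv.toContinuousLinearMap

theorem ofReal_norm_sq_eq_lintegral (f : L2) :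
    ENNReal.ofReal (‖f‖ ^ 2) = ∫⁻ x : ℝ, ‖f x‖ₑ ^ 2 := by
  have h : ‖f‖ₑ = (∫⁻ x : ℝ, ‖f x‖ₑ ^ 2) ^ (1 / 2 : ℝ) := by
    rw [Lp.enorm_def, eLpNorm_eq_lintegral_rpow_enorm_toReal two_ne_zero ENNReal.ofNat_ne_top]
    simp
  rw [ENNReal.ofReal_pow (norm_nonneg _), ofReal_norm, h, ← ENNReal.rpow_natCast,
    ← ENNReal.rpow_mul]
  simp

/-- The spectral density of `f` on the Fourier side. -/
def fourierDensity (f : L2) : Measure ℝ := volume.withDensity fun ξ => ‖FT f ξ‖ₑ ^ 2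

theorem measurable_enorm_sq (f : L2) : Measurable fun ξ => ‖f ξ‖ₑ ^ 2 :=
  (Lp.stronglyMeasurable f).measurable.enorm.pow_const 2

/-- Plancherel turns `‖E(s) f‖²` into the integral of `|FT f|²` over `symb⁻¹(s)`. Both the spectral
resolution property and absolute continuity are read off from this formula. -/
theorem freePVM_vectorMeasure (f : L2) :
    freePVM.vectorMeasure f = (fourierDensity f).map symb := by
  refine Measure.ext fun s hs => ?_
  have hm := measurable_symb hs
  rw [ProjectionValuedMeasure.vectorMeasure_apply _ _ hs, Measure.map_apply measurable_symb hs,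
    fourierDensity, withDensity_apply _ hm]
  change ENNReal.ofReal (‖freeProj s f‖ ^ 2) = _
  rw [freeProj_apply, LinearIsometryEquiv.norm_map, ofReal_norm_sq_eq_lintegral,
    ← lintegral_indicator hm]
  refine lintegral_congr_ae ?_
  filter_upwards [indOp_coeFn hm (FT f)] with ξ h
  rw [h]
  by_cases hξ : ξ ∈ symb ⁻¹' s <;> simp [hξ]

theorem isSpectralResolution_freeL : IsSpectralResolution freeL freePVM := by
  constructor
  · intro f
    have h1 : f ∈ freeL.domain ↔
        MemLp (fun ξ => (symb ξ : ℂ) * FT f ξ) 2 (volume : Measure ℝ) := mem_freeDomain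
    have hm : AEStronglyMeasurable (fun ξ => (symb ξ : ℂ) * FT f ξ) volume :=
      measurable_symbC.aestronglyMeasurable.mul (Lp.aestronglyMeasurable _)
    rw [h1, freePVM_vectorMeasure, lintegral_map (by fun_prop) measurable_symb, fourierDensity,
      lintegral_withDensity_eq_lintegral_mul _ (measurable_enorm_sq _)
        ((measurable_symb.pow_const 2).ennreal_ofReal), MemLp, and_iff_right hm,
      eLpNorm_lt_top_iff_lintegral_rpow_enorm_lt_top two_ne_zero ENNReal.ofNat_ne_top]
    refine iff_of_eq (congrArg (· < ⊤) (lintegral_congr fun ξ => ?_))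
    rw [enorm_mul, ENNReal.toReal_ofNat, ENNReal.rpow_ofNat, mul_pow, Pi.mul_apply, mul_comm,
      ENNReal.ofReal_pow (symb_nonneg ξ), ← ofReal_norm (symb ξ : ℂ), Complex.norm_real,
      Real.norm_of_nonneg (symb_nonneg ξ)]
  · intro f
    rw [freePVM_vectorMeasure, integral_map measurable_symb.aemeasurable
      (by fun_prop), fourierDensity, integral_withDensity_eq_integral_toReal_smul
        (measurable_enorm_sq _) (ae_of_all _ fun ξ => by simp),
      ← FT.inner_map_map, L2.inner_def, ← integral_complex_ofReal]
    refine integral_congr_ae ?_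
    filter_upwards [FT_freeL f] with ξ h
    rw [h, RCLike.inner_apply, mul_assoc, RCLike.mul_conj, ENNReal.toReal_pow, toReal_enorm]
    simp [mul_comm]

/-! ### Absolute continuity -/

/-- Apart from the point `0`, the preimage is covered by the images of `s ∩ (0, ∞)` under the two
inverse branches `±√t / (2π)`. These are differentiable there, and differentiable maps of the line
send null sets to null sets. -/
theorem volume_preimage_symb {s : Set ℝ} (hs : volume s = 0) : volume (symb ⁻¹' s) = 0 := by
  have hpi : (2 * Real.pi) ≠ 0 := by positivity
  set u : Set ℝ := s ∩ Ioi 0 with hu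
  have hu0 : volume u = 0 := measure_mono_null inter_subset_left hs
  have hdiff : DifferentiableOn ℝ (fun t => Real.sqrt t / (2 * Real.pi)) u := fun t ht =>
    ((differentiableAt_id.sqrt (ne_of_gt ht.2)).div_const _).differentiableWithinAt
  have h1 : volume ((fun t => Real.sqrt t / (2 * Real.pi)) '' u) = 0 :=
    addHaar_image_eq_zero_of_differentiableOn_of_addHaar_eq_zero volume hdiff hu0
  have h2 : volume ((fun t => -(Real.sqrt t / (2 * Real.pi))) '' u) = 0 :=
    addHaar_image_eq_zero_of_differentiableOn_of_addHaar_eq_zero volume hdiff.neg hu0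
  refine measure_mono_null (t := (((fun t => Real.sqrt t / (2 * Real.pi)) '' u) ∪
    ((fun t => -(Real.sqrt t / (2 * Real.pi))) '' u)) ∪ {0}) (fun ξ hξ => ?_)
    (measure_union_null (measure_union_null h1 h2) (measure_singleton 0))
  rcases lt_trichotomy ξ 0 with h | h | h
  · refine Or.inl (Or.inr ⟨symb ξ, ⟨hξ, ?_⟩, ?_⟩)
    · exact sq_pos_of_ne_zero (mul_ne_zero hpi h.ne)
    · simp only [symb, Real.sqrt_sq_eq_abs, abs_mul, abs_of_neg h, abs_of_pos Real.pi_pos, abs_two]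
      field_simp
  · exact Or.inr h
  · refine Or.inl (Or.inl ⟨symb ξ, ⟨hξ, ?_⟩, ?_⟩)
    · exact sq_pos_of_ne_zero (mul_ne_zero hpi h.ne')
    · simp only [symb, Real.sqrt_sq_eq_abs, abs_mul, abs_of_pos h, abs_of_pos Real.pi_pos, abs_two]
      field_simp

theorem freePVM_acSubspace : freePVM.acSubspace = ⊤ := by
  refine eq_top_iff.2 fun f _ => ?_
  change freePVM.vectorMeasure f ≪ volume
  refine Measure.AbsolutelyContinuous.mk fun s hs h0 => ?_
  rw [freePVM_vectorMeasure, Measure.map_apply measurable_symb hs]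
  exact withDensity_absolutelyContinuous _ _ (volume_preimage_symb h0)

theorem acSpectrum_freeL : acSpectrum freeL freePVM = Complex.ofReal '' Ici 0 := by
  rw [acSpectrum, freePVM_acSubspace, opSpectrum_part_top, opSpectrum_freeL]

/-! ### Traces of nuclear operators -/

/-- Cauchy–Schwarz followed by Bessel's inequality. The bound is uniform in the finite set, which
gives the absolute summability needed to interchange sums in the trace. -/
theorem sum_norm_inner_mul_inner_le {H ι : Type*} [NormedAddCommGroup H] [InnerProductSpace ℂ H]
    {e : ι → H} (he : Orthonormal ℂ e) (u v : H) (s : Finset ι) :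
    ∑ i ∈ s, ‖inner ℂ u (e i) * inner ℂ (e i) v‖ ≤ ‖u‖ * ‖v‖ := by
  refine (sq_le_sq₀ (Finset.sum_nonneg fun _ _ => norm_nonneg _) (by positivity)).1 ?_
  calc (∑ i ∈ s, ‖inner ℂ u (e i) * inner ℂ (e i) v‖) ^ 2
      = (∑ i ∈ s, ‖inner ℂ (e i) u‖ * ‖inner ℂ (e i) v‖) ^ 2 := by
        congr 1
        exact Finset.sum_congr rfl fun i _ => by rw [norm_mul, norm_inner_symm u]
    _ ≤ (∑ i ∈ s, ‖inner ℂ (e i) u‖ ^ 2) * ∑ i ∈ s, ‖inner ℂ (e i) v‖ ^ 2 :=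
        Finset.sum_mul_sq_le_sq_mul_sq _ _ _
    _ ≤ ‖u‖ ^ 2 * ‖v‖ ^ 2 := by
        gcongr
        · exact he.sum_inner_products_le u
        · exact he.sum_inner_products_le v
    _ = (‖u‖ * ‖v‖) ^ 2 := by ring

/-- The trace of a nuclear operator `∑ ⟨u n, ·⟩ v n` is `∑ ⟨u n, v n⟩`. -/
theorem hasTrace_of_hasSum {H : Type*} [NormedAddCommGroup H] [InnerProductSpace ℂ H]
    [CompleteSpace H] {A : H →L[ℂ] H} {u v : ℕ → H} (hs : Summable fun n => ‖u n‖ * ‖v n‖)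
    (hA : ∀ x, HasSum (fun n => inner ℂ (u n) x • v n) (A x)) {t : ℂ}
    (ht : HasSum (fun n => inner ℂ (u n) (v n)) t) : HasTrace A t := by
  intro ι e
  set F : ℕ × ι → ℂ := fun p => inner ℂ (u p.1) (e p.2) * inner ℂ (e p.2) (v p.1) with hF
  have hle := fun n => sum_norm_inner_mul_inner_le e.orthonormal (u n) (v n)
  have hsum : Summable F := by
    refine Summable.of_norm ((summable_prod_of_nonneg fun _ => norm_nonneg _).2 ⟨fun n => ?_, ?_⟩)
    · exact (e.summable_inner_mul_inner (u n) (v n)).norm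
    · exact Summable.of_nonneg_of_le (fun n => tsum_nonneg fun _ => norm_nonneg _)
        (fun n => Real.tsum_le_of_sum_le (fun _ => norm_nonneg _) (hle n)) hs
  obtain ⟨S, hS⟩ := hsum
  have h1 : HasSum (fun n => inner ℂ (u n) (v n)) S :=
    hS.prod_fiberwise fun n => e.hasSum_inner_mul_inner (u n) (v n)
  rw [ht.unique h1]
  -- The same double series summed over `n` first yields `⟨e i, A (e i)⟩`; summing over the basis
  -- first gave `⟨u n, v n⟩` by Parseval.
  refine HasSum.prod_fiberwise (f := F ∘ Prod.swap) ((Equiv.prodComm ι ℕ).hasSum_iff.2 hS)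
    fun i => ?_
  have := (hA (e i)).mapL (innerSL ℂ (e i))
  simpa only [innerSL_apply_apply, inner_smul_right, hF, Function.comp_def, Prod.swap] using this

/-! ### The Fourier transform on `L¹ ∩ L²` -/

/-- The `L²` transform agrees with the distributional one, while the Fourier integral satisfies `∫
(𝓕φ) g = ∫ φ (𝓕g)` by Fubini. Both therefore have the same pairings with smooth compactly supported
functions, which determine a locally integrable function a.e. -/
theorem FT_coeFn_of_integrable {g : ℝ → ℂ} (hg : MemLp g 2 (volume : Measure ℝ))
    (hi : Integrable g) : FT (hg.toLp g) =ᵐ[volume] 𝓕 g := by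
  have hc : Continuous (𝓕 g) :=
    VectorFourier.fourierIntegral_continuous Real.continuous_fourierChar continuous_inner hi
  refine ae_eq_of_integral_contDiff_smul_eq ((Lp.memLp _).locallyIntegrable one_le_two)
    hc.locallyIntegrable fun χ hχ hχc => ?_
  let φ : 𝓢(ℝ, ℂ) := (hχc.comp_left (g := Complex.ofReal) Complex.ofReal_zero).toSchwartzMap
    (Complex.ofRealCLM.contDiff.comp hχ)
  have h1 := congrArg (fun T : 𝓢'(ℝ, ℂ) => T φ)
    (Lp.fourier_toTemperedDistribution_eq (hg.toLp g))
  simp only [TemperedDistribution.fourier_apply, Lp.toTemperedDistribution_apply] at h1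
  have h2 : ∫ x, 𝓕 φ x • hg.toLp g x = ∫ x, 𝓕 φ x • g x := by
    refine integral_congr_ae ?_
    filter_upwards [hg.coeFn_toLp] with x hx
    rw [hx]
  have h3 : ∫ x, 𝓕 φ x • g x = ∫ x, φ x • 𝓕 g x := by
    simpa using! (VectorFourier.integral_fourierIntegral_smul_eq_flip (L := innerₗ ℝ)
      Real.continuous_fourierChar continuous_inner φ.integrable hi)
  calc ∫ x, χ x • FT (hg.toLp g) x = ∫ x, φ x • FT (hg.toLp g) x :=
        integral_congr_ae (ae_of_all _ fun x => (Complex.coe_smul (χ x) _).symm)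
    _ = ∫ x, φ x • 𝓕 g x := h1.symm.trans (h2.trans h3)
    _ = ∫ x, χ x • 𝓕 g x :=
        integral_congr_ae (ae_of_all _ fun x => Complex.coe_smul (χ x) _)

theorem FT_symm_coeFn_of_integrable {g : ℝ → ℂ} (hg : MemLp g 2 (volume : Measure ℝ))
    (hi : Integrable g) : FT.symm (hg.toLp g) =ᵐ[volume] 𝓕⁻ g := by
  have hc : Continuous (𝓕⁻ g) :=
    VectorFourier.fourierIntegral_continuous Real.continuous_fourierChar continuous_inner.neg hi
  refine ae_eq_of_integral_contDiff_smul_eq ((Lp.memLp _).locallyIntegrable one_le_two)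
    hc.locallyIntegrable fun χ hχ hχc => ?_
  let φ : 𝓢(ℝ, ℂ) := (hχc.comp_left (g := Complex.ofReal) Complex.ofReal_zero).toSchwartzMap
    (Complex.ofRealCLM.contDiff.comp hχ)
  have h1 := congrArg (fun T : 𝓢'(ℝ, ℂ) => T φ)
    (Lp.fourierInv_toTemperedDistribution_eq (hg.toLp g))
  simp only [TemperedDistribution.fourierInv_apply, Lp.toTemperedDistribution_apply] at h1
  have h2 : ∫ x, 𝓕⁻ φ x • hg.toLp g x = ∫ x, 𝓕⁻ φ x • g x := by
    refine integral_congr_ae ?_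
    filter_upwards [hg.coeFn_toLp] with x hx
    rw [hx]
  have h3 : ∫ x, 𝓕⁻ φ x • g x = ∫ x, φ x • 𝓕⁻ g x := by
    -- The inverse transform is the Fourier integral for the negated pairing, which is again
    -- symmetric.
    have := VectorFourier.integral_fourierIntegral_smul_eq_flip (L := -innerₗ ℝ)
      (μ := volume) (ν := volume) Real.continuous_fourierChar continuous_inner.neg φ.integrable hi
    have hfl : (-innerₗ ℝ : ℝ →ₗ[ℝ] ℝ →ₗ[ℝ] ℝ).flip = -innerₗ ℝ := by
      ext; simp
    rw [hfl] at this
    rw [SchwartzMap.fourierInv_coe]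
    exact this
  calc ∫ x, χ x • FT.symm (hg.toLp g) x = ∫ x, φ x • FT.symm (hg.toLp g) x :=
        integral_congr_ae (ae_of_all _ fun x => (Complex.coe_smul (χ x) _).symm)
    _ = ∫ x, φ x • 𝓕⁻ g x := h1.symm.trans (h2.trans h3)
    _ = ∫ x, χ x • 𝓕⁻ g x :=
        integral_congr_ae (ae_of_all _ fun x => Complex.coe_smul (χ x) _)

/-! ### Functions cut off to bounded intervals -/

theorem memLp_indicator_Ioo {g : ℝ → ℂ} (hg : Continuous g) (a b : ℝ) :
    MemLp ((Ioo a b).indicator g) 2 (volume : Measure ℝ) := by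
  rw [memLp_indicator_iff_restrict measurableSet_Ioo]
  obtain ⟨C, hC⟩ := (isCompact_Icc (a := a) (b := b)).exists_bound_of_continuousOn hg.continuousOn
  refine MemLp.of_bound hg.aestronglyMeasurable C ?_
  filter_upwards [ae_restrict_mem measurableSet_Ioo] with x hx
  exact hC x (Ioo_subset_Icc_self hx)

theorem integrable_indicator_Ioo {g : ℝ → ℂ} (hg : Continuous g) (a b : ℝ) :
    Integrable ((Ioo a b).indicator g) :=
  (hg.integrableOn_Icc.mono_set Ioo_subset_Icc_self).integrable_indicator measurableSet_Ioo

/-- The function `g 1_{(a, b)}` as an element of `L²(ℝ)`. -/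
def boxFun (a b : ℝ) (g : C(ℝ, ℂ)) : L2 := (memLp_indicator_Ioo g.continuous a b).toLp _

theorem boxFun_coeFn (a b : ℝ) (g : C(ℝ, ℂ)) :
    boxFun a b g =ᵐ[volume] (Ioo a b).indicator g := MemLp.coeFn_toLp _

theorem norm_boxFun_le {a b : ℝ} {g : C(ℝ, ℂ)} {C : ℝ} (hC : ∀ x ∈ Ioo a b, ‖g x‖ ≤ C) :
    ‖boxFun a b g‖ ≤ C * ‖boxFun a b 1‖ := by
  refine Lp.norm_le_mul_norm_of_ae_le_mul ?_
  filter_upwards [boxFun_coeFn a b g, boxFun_coeFn a b 1] with x h1 h2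
  rw [h1, h2]
  by_cases h : x ∈ Ioo a b
  · simpa [h] using hC x h
  · simp [h]

theorem inner_boxFun (a b : ℝ) (g : C(ℝ, ℂ)) (f : L2) :
    inner ℂ (boxFun a b g) f = ∫ y in Ioo a b, star (g y) * f y := by
  rw [L2.inner_def, ← integral_indicator measurableSet_Ioo]
  refine integral_congr_ae ?_
  filter_upwards [boxFun_coeFn a b g] with x h
  rw [h]
  by_cases hx : x ∈ Ioo a b <;> simp [hx, mul_comm]

/-! ### The band-limiting projection -/

theorem symb_preimage_Iio : symb ⁻¹' Iio (Real.pi ^ 2) = Ioo (-(1 / 2)) (1 / 2) := by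
  ext ξ
  rw [mem_preimage, mem_Iio, symb, sq_lt_sq, abs_mul, abs_mul, abs_two, abs_of_pos Real.pi_pos,
    mem_Ioo, ← abs_lt, mul_assoc, ← lt_div_iff₀' two_pos, mul_comm, ← lt_div_iff₀ Real.pi_pos]
  rw [div_div, mul_comm 2, ← div_div, div_self Real.pi_ne_zero]

/-- The Fourier transform of `f 1_{(a, b)}`, as a pointwise defined function. -/
def boxFourier (a b : ℝ) (f : L2) : ℝ → ℂ := 𝓕 ((Ioo a b).indicator f)

theorem integrable_indicator_L2 (a b : ℝ) (f : L2) : Integrable ((Ioo a b).indicator f) := by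
  have h := (memLp_indicator_iff_restrict measurableSet_Ioo).1 (memLp_indicator a b f)
  exact IntegrableOn.integrable_indicator (h.integrable one_le_two) measurableSet_Ioo

theorem FT_indicatorMul (a b : ℝ) (f : L2) :
    FT (indicatorMul a b f) =ᵐ[volume] boxFourier a b f :=
  FT_coeFn_of_integrable (memLp_indicator a b f) (integrable_indicator_L2 a b f)

theorem continuous_boxFourier (a b : ℝ) (f : L2) : Continuous (boxFourier a b f) :=
  VectorFourier.fourierIntegral_continuous Real.continuous_fourierChar continuous_inner
    (integrable_indicator_L2 a b f)

/-- The operator `1_{(-∞, π²)}(L) 1_{(a, b)}`. -/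
def bandOp (a b : ℝ) : L2 →L[ℂ] L2 := freePVM.proj (Iio (Real.pi ^ 2)) ∘L indicatorMul a b

/-- The inequality `(2πξ)² < π²` means `|ξ| < 1/2`, so the operator is an inverse transform over
this window of a continuous, pointwise defined function. -/
theorem bandOp_apply (a b : ℝ) (f : L2) :
    bandOp a b f = FT.symm (boxFun (-(1 / 2)) (1 / 2) ⟨_, continuous_boxFourier a b f⟩) := by
  change FT.symm (indOp (symb ⁻¹' Iio (Real.pi ^ 2)) (FT (indicatorMul a b f))) = _
  rw [symb_preimage_Iio]
  congr 1
  refine Lp.ext ?_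
  filter_upwards [indOp_coeFn (measurableSet_Ioo (a := -(1 / 2 : ℝ)) (b := 1 / 2))
      (FT (indicatorMul a b f)), FT_indicatorMul a b f,
    boxFun_coeFn (-(1 / 2)) (1 / 2) ⟨_, continuous_boxFourier a b f⟩] with ξ h1 h2 h3
  rw [h1, h3]
  by_cases h : ξ ∈ Ioo (-(1 / 2 : ℝ)) (1 / 2)
  · simp only [indicator_of_mem h, h2, ContinuousMap.coe_mk]
  · simp only [indicator_of_notMem h]

theorem hasSum_exp_taylor (y ξ : ℝ) :
    HasSum (fun n : ℕ => (-2 * Real.pi * Complex.I * y) ^ n / n.factorial * (ξ : ℂ) ^ n)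
      (Complex.exp (((-2 * Real.pi * y * ξ : ℝ) : ℂ) * Complex.I)) := by
  have h := NormedSpace.expSeries_div_hasSum_exp (𝔸 := ℂ)
    (((-2 * Real.pi * y * ξ : ℝ) : ℂ) * Complex.I)
  rw [← Complex.exp_eq_exp_ℂ] at h
  refine h.congr_fun fun n => ?_
  rw [div_mul_eq_mul_div, ← mul_pow]
  push_cast
  ring_nf

/-- The left factors in the nuclear representation of `1_{(-∞, π²)}(L) 1_{(a, b)}`. -/
def bandLeft (a b : ℝ) (n : ℕ) : L2 :=
  boxFun a b ⟨fun y => (2 * Real.pi * Complex.I * y) ^ n / n.factorial, by fun_prop⟩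

/-- The Fourier transforms of the right factors in the nuclear representation. -/
def bandRight (n : ℕ) : L2 := boxFun (-(1 / 2)) (1 / 2) ⟨fun ξ => (ξ : ℂ) ^ n, by fun_prop⟩

theorem norm_bandRight_le (n : ℕ) : ‖bandRight n‖ ≤ 1 * ‖boxFun (-(1 / 2)) (1 / 2) 1‖ := by
  refine norm_boxFun_le fun ξ hξ => ?_
  rw [ContinuousMap.coe_mk, norm_pow, Complex.norm_real]
  exact pow_le_one₀ (norm_nonneg _) (by rw [Real.norm_eq_abs, abs_le]; constructor <;>
    linarith [hξ.1, hξ.2])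

theorem norm_taylor_coeff_le {a b y : ℝ} (hy : y ∈ Ioo a b) (n : ℕ) :
    ‖(-2 * Real.pi * Complex.I * y : ℂ) ^ n / n.factorial‖ ≤
      (2 * Real.pi * max |a| |b|) ^ n / n.factorial := by
  have hy' : |y| ≤ max |a| |b| := abs_le_max_abs_abs hy.1.le hy.2.le
  rw [norm_div, norm_pow, Complex.norm_natCast]
  gcongr
  simp only [norm_mul, norm_neg, Complex.norm_ofNat, Complex.norm_real, Complex.norm_I, mul_one,
    Real.norm_eq_abs, abs_of_pos Real.pi_pos]
  gcongr

/-- The inner product is conjugate linear in its first slot, so `bandLeft` carries the sign opposite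
to that in `exp(-2πi y ξ)`. -/
theorem star_taylor_coeff (y : ℝ) (n : ℕ) :
    star ((2 * Real.pi * Complex.I * y : ℂ) ^ n / n.factorial) =
      (-2 * Real.pi * Complex.I * y) ^ n / n.factorial := by
  simp [Complex.conj_ofReal]

theorem norm_bandLeft_le (a b : ℝ) (n : ℕ) :
    ‖bandLeft a b n‖ ≤ (2 * Real.pi * max |a| |b|) ^ n / n.factorial * ‖boxFun a b 1‖ := by
  refine norm_boxFun_le fun y hy => ?_
  have := norm_taylor_coeff_le hy n
  rwa [← star_taylor_coeff, norm_star] at this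

/-- The left factors decay factorially because `(a, b)` is bounded; the right factors stay bounded
because `|ξ| < 1` on the window. -/
theorem summable_band (a b : ℝ) :
    Summable fun n => ‖bandLeft a b n‖ * ‖FT.symm (bandRight n)‖ := by
  refine Summable.of_nonneg_of_le (fun n => by positivity) (fun n => ?_)
    ((Real.summable_pow_div_factorial (2 * Real.pi * max |a| |b|)).mul_right
      (‖boxFun a b 1‖ * (1 * ‖boxFun (-(1 / 2)) (1 / 2) 1‖)))
  rw [LinearIsometryEquiv.norm_map, ← mul_assoc]
  gcongr
  · exact norm_bandLeft_le a b n
  · exact norm_bandRight_le n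

theorem inner_bandLeft (a b : ℝ) (n : ℕ) (f : L2) :
    inner ℂ (bandLeft a b n) f =
      ∫ y in Ioo a b, (-2 * Real.pi * Complex.I * y) ^ n / n.factorial * f y := by
  rw [bandLeft, inner_boxFun]
  simp only [ContinuousMap.coe_mk, star_taylor_coeff]

/-- The power series of the Fourier transform of a compactly supported function. -/
theorem hasSum_boxFourier (a b : ℝ) (f : L2) (ξ : ℝ) :
    HasSum (fun n => inner ℂ (bandLeft a b n) f * (ξ : ℂ) ^ n) (boxFourier a b f ξ) := by
  have hf : Integrable f (volume.restrict (Ioo a b)) :=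
    (integrable_indicator_iff measurableSet_Ioo).1 (integrable_indicator_L2 a b f)
  have h1 : boxFourier a b f ξ =
      ∫ y in Ioo a b, Complex.exp (((-2 * Real.pi * y * ξ : ℝ) : ℂ) * Complex.I) * f y := by
    rw [boxFourier, Real.fourier_real_eq_integral_exp_smul, ← integral_indicator measurableSet_Ioo]
    refine integral_congr_ae (ae_of_all _ fun y => ?_)
    by_cases h : y ∈ Ioo a b <;> simp [h]
  have h2 : ∀ n, inner ℂ (bandLeft a b n) f * (ξ : ℂ) ^ n = ∫ y in Ioo a b,
      (-2 * Real.pi * Complex.I * y) ^ n / n.factorial * (ξ : ℂ) ^ n * f y := by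
    intro n
    rw [inner_bandLeft, ← integral_mul_const]
    exact integral_congr_ae (ae_of_all _ fun y => by ring)
  simp_rw [h1, h2]
  have hsm : Summable fun n : ℕ => (2 * Real.pi * max |a| |b|) ^ n / n.factorial * |ξ| ^ n := by
    refine (Real.summable_pow_div_factorial (2 * Real.pi * max |a| |b| * |ξ|)).congr fun n => ?_
    rw [mul_pow]
    ring
  refine hasSum_integral_of_dominated_convergence
    (fun n y => (2 * Real.pi * max |a| |b|) ^ n / n.factorial * |ξ| ^ n * ‖f y‖)
    (fun n => ?_) (fun n => ?_) ?_ ?_ ?_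
  · exact (Continuous.aestronglyMeasurable (by fun_prop)).mul hf.1
  · filter_upwards [ae_restrict_mem measurableSet_Ioo] with y hy
    rw [norm_mul, norm_mul, norm_pow, Complex.norm_real, Real.norm_eq_abs]
    gcongr
    exact norm_taylor_coeff_le hy n
  · exact ae_of_all _ fun y => hsm.mul_right _
  · simp_rw [tsum_mul_right]
    exact hf.norm.const_mul _
  · exact ae_of_all _ fun y => (hasSum_exp_taylor y ξ).mul_right _

theorem sum_bandRight_coeFn (c : ℕ → ℂ) (S : Finset ℕ) :
    (∑ n ∈ S, c n • bandRight n : L2) =ᵐ[volume]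
      (Ioo (-(1 / 2 : ℝ)) (1 / 2)).indicator fun ξ => ∑ n ∈ S, c n * (ξ : ℂ) ^ n := by
  induction S using Finset.induction_on with
  | empty =>
    simp only [Finset.sum_empty]
    filter_upwards [Lp.coeFn_zero ℂ 2 (volume : Measure ℝ)] with ξ h
    rw [h, indicator_zero, Pi.zero_apply]
  | insert n S hn ih =>
    simp_rw [Finset.sum_insert hn]
    filter_upwards [Lp.coeFn_add (c n • bandRight n) (∑ n ∈ S, c n • bandRight n),
      Lp.coeFn_smul (c n) (bandRight n), ih, boxFun_coeFn (-(1 / 2)) (1 / 2)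
        ⟨fun ξ => (ξ : ℂ) ^ n, by fun_prop⟩] with ξ h1 h2 h3 h4
    rw [h1, Pi.add_apply, h2, h3, Pi.smul_apply, bandRight, h4]
    by_cases h : ξ ∈ Ioo (-(1 / 2 : ℝ)) (1 / 2)
    · simp only [indicator_of_mem h, ContinuousMap.coe_mk, smul_eq_mul]
    · simp only [indicator_of_notMem h, smul_eq_mul, mul_zero, add_zero]

/-- The power series of the Fourier transform of `f 1_{(a, b)}` converges pointwise. On the window
`|ξ|ⁿ ≤ 1`, so its partial sums and its limit are bounded by one constant `K`, and dominated
convergence upgrades this to `L²` convergence. -/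
theorem hasSum_bandOp (a b : ℝ) (f : L2) :
    HasSum (fun n => inner ℂ (bandLeft a b n) f • FT.symm (bandRight n)) (bandOp a b f) := by
  rw [bandOp_apply]
  suffices h : HasSum (fun n => inner ℂ (bandLeft a b n) f • bandRight n)
      (boxFun (-(1 / 2)) (1 / 2) ⟨_, continuous_boxFourier a b f⟩) by
    have := h.mapL FT.symm.toContinuousLinearEquiv.toContinuousLinearMap
    simp only [map_smul] at this
    exact this
  have hsum : Summable fun n => ‖inner ℂ (bandLeft a b n) f‖ := by
    refine Summable.of_nonneg_of_le (fun n => norm_nonneg _)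
      (fun n => (norm_inner_le_norm _ _).trans
        (mul_le_mul_of_nonneg_right (norm_bandLeft_le a b n) (norm_nonneg f)))
      (((Real.summable_pow_div_factorial _).mul_right _).mul_right _)
  set K := ∑' n, ‖inner ℂ (bandLeft a b n) f‖ with hK
  have hpart : ∀ (S : Finset ℕ), ∀ ξ ∈ Ioo (-(1 / 2 : ℝ)) (1 / 2),
      ‖∑ n ∈ S, inner ℂ (bandLeft a b n) f * (ξ : ℂ) ^ n‖ ≤ K := by
    intro S ξ hξ
    refine (norm_sum_le _ _).trans ((Finset.sum_le_sum fun n _ => ?_).trans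
      (hsum.sum_le_tsum S fun _ _ => norm_nonneg _))
    rw [norm_mul, norm_pow, Complex.norm_real]
    refine mul_le_of_le_one_right (norm_nonneg _) (pow_le_one₀ (norm_nonneg _) ?_)
    rw [Real.norm_eq_abs, abs_le]
    constructor <;> linarith [hξ.1, hξ.2]
  have hlim : ∀ ξ ∈ Ioo (-(1 / 2 : ℝ)) (1 / 2), ‖boxFourier a b f ξ‖ ≤ K := fun ξ hξ =>
    le_of_tendsto (hasSum_boxFourier a b f ξ).norm
      (Filter.Eventually.of_forall fun S => hpart S ξ hξ)
  refine tendsto_L2_of_dominated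
    (g := fun ξ => ‖(Ioo (-(1 / 2 : ℝ)) (1 / 2)).indicator (fun _ => ((K + K : ℝ) : ℂ)) ξ‖)
    (memLp_indicator_Ioo continuous_const _ _).norm (fun S => ?_) ?_
  · filter_upwards [sum_bandRight_coeFn (fun n => inner ℂ (bandLeft a b n) f) S,
      boxFun_coeFn (-(1 / 2)) (1 / 2) ⟨_, continuous_boxFourier a b f⟩] with ξ h1 h2
    rw [h1, h2]
    by_cases h : ξ ∈ Ioo (-(1 / 2 : ℝ)) (1 / 2)
    · simp only [indicator_of_mem h, ContinuousMap.coe_mk]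
      rw [Complex.norm_real]
      exact ((norm_sub_le _ _).trans (add_le_add (hpart S ξ h) (hlim ξ h))).trans
        (Real.le_norm_self _)
    · simp only [indicator_of_notMem h, sub_self, le_refl]
  · filter_upwards [ae_all_iff.2 fun S => sum_bandRight_coeFn
        (fun n => inner ℂ (bandLeft a b n) f) S,
      boxFun_coeFn (-(1 / 2)) (1 / 2) ⟨_, continuous_boxFourier a b f⟩] with ξ h1 h2
    simp_rw [h1, h2]
    by_cases h : ξ ∈ Ioo (-(1 / 2 : ℝ)) (1 / 2)
    · simp only [indicator_of_mem h, ContinuousMap.coe_mk]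
      exact hasSum_boxFourier a b f ξ
    · simp only [indicator_of_notMem h]
      exact tendsto_const_nhds

theorem isTraceClass_bandOp (a b : ℝ) : IsTraceClass (bandOp a b) :=
  ⟨bandLeft a b, fun n => FT.symm (bandRight n), summable_band a b, hasSum_bandOp a b⟩

/-! ### The trace of the band-limiting operator -/

theorem FT_symm_bandRight (n : ℕ) : FT.symm (bandRight n) =ᵐ[volume] fun y =>
    ∫ ξ in Ioo (-(1 / 2 : ℝ)) (1 / 2),
      Complex.exp (((2 * Real.pi * y * ξ : ℝ) : ℂ) * Complex.I) * (ξ : ℂ) ^ n := by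
  have hc : Continuous fun ξ : ℝ => (ξ : ℂ) ^ n := by fun_prop
  refine (FT_symm_coeFn_of_integrable (memLp_indicator_Ioo hc (-(1 / 2)) (1 / 2))
    (integrable_indicator_Ioo hc _ _)).trans (ae_of_all _ fun y => ?_)
  rw [Real.fourierInv_eq']
  beta_reduce
  rw [← integral_indicator measurableSet_Ioo]
  refine integral_congr_ae (ae_of_all _ fun ξ => ?_)
  by_cases h : ξ ∈ Ioo (-(1 / 2 : ℝ)) (1 / 2)
  · simp only [indicator_of_mem h, smul_eq_mul, RCLike.inner_apply, conj_trivial, mul_assoc]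
  · simp only [indicator_of_notMem h, smul_zero]

/-- Each pairing is an integral over the rectangle `Q` of a Taylor term of `exp(-2πi y ξ)` times
`exp(2πi y ξ)`. Summing under the integral leaves the constant `1`, hence the area of `Q`; the
second side has length `1`. -/
theorem hasSum_trace_bandOp {a b : ℝ} (hab : a < b) :
    HasSum (fun n => inner ℂ (bandLeft a b n) (FT.symm (bandRight n))) ((b - a : ℝ) : ℂ) := by
  set Q : Set (ℝ × ℝ) := Ioo a b ×ˢ Ioo (-(1 / 2 : ℝ)) (1 / 2) with hQ
  set F : ℕ → ℝ × ℝ → ℂ := fun n p =>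
    (-2 * Real.pi * Complex.I * p.1) ^ n / n.factorial * (p.2 : ℂ) ^ n *
      Complex.exp (((2 * Real.pi * p.1 * p.2 : ℝ) : ℂ) * Complex.I) with hF
  have hFc : ∀ n, Continuous (F n) := fun n => by simp only [hF]; fun_prop
  have hQm : MeasurableSet Q := measurableSet_Ioo.prod measurableSet_Ioo
  have hQv : volume Q = ENNReal.ofReal (b - a) := by
    rw [hQ, Measure.volume_eq_prod, Measure.prod_prod, Real.volume_Ioo, Real.volume_Ioo]
    norm_num
  have hQf : IsFiniteMeasure ((volume : Measure (ℝ × ℝ)).restrict Q) :=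
    ⟨by rw [Measure.restrict_apply_univ, hQv]; exact ENNReal.ofReal_lt_top⟩
  have hFi : ∀ n, IntegrableOn (F n) Q := fun n =>
    ((hFc n).continuousOn.integrableOn_compact
      (isCompact_Icc.prod isCompact_Icc)).mono_set
      (prod_mono Ioo_subset_Icc_self Ioo_subset_Icc_self)
  have h1 : ∀ n, inner ℂ (bandLeft a b n) (FT.symm (bandRight n)) = ∫ p in Q, F n p := by
    intro n
    rw [inner_bandLeft, Measure.volume_eq_prod, setIntegral_prod _ (hFi n)]
    refine integral_congr_ae ?_
    filter_upwards [ae_restrict_of_ae (FT_symm_bandRight n)] with y hy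
    rw [hy, ← integral_const_mul]
    refine integral_congr_ae (ae_of_all _ fun ξ => ?_)
    simp only [hF]
    ring
  have h2 : ((b - a : ℝ) : ℂ) = ∫ _ in Q, (1 : ℂ) := by
    rw [setIntegral_const, measureReal_def, hQv, ENNReal.toReal_ofReal (by linarith),
      Complex.real_smul, mul_one]
  simp_rw [h1, h2]
  refine hasSum_integral_of_dominated_convergence
    (fun n _ => (2 * Real.pi * max |a| |b|) ^ n / n.factorial)
    (fun n => (hFc n).aestronglyMeasurable) (fun n => ?_)
    (ae_of_all _ fun _ => Real.summable_pow_div_factorial _) (integrable_const _)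
    (ae_of_all _ fun p => ?_)
  · filter_upwards [ae_restrict_mem hQm] with p hp
    simp only [hF]
    rw [norm_mul, Complex.norm_exp_ofReal_mul_I, mul_one, norm_mul]
    refine (mul_le_of_le_one_right (norm_nonneg _) ?_).trans (norm_taylor_coeff_le hp.1 n)
    rw [norm_pow, Complex.norm_real]
    refine pow_le_one₀ (norm_nonneg _) ?_
    rw [Real.norm_eq_abs, abs_le]
    constructor <;> linarith [hp.2.1, hp.2.2]
  · have := (hasSum_exp_taylor p.1 p.2).mul_right
      (Complex.exp (((2 * Real.pi * p.1 * p.2 : ℝ) : ℂ) * Complex.I))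
    rw [← Complex.exp_add] at this
    convert! this using 1
    rw [← Complex.exp_zero]
    congr 1
    push_cast
    ring

theorem hasTrace_bandOp {a b : ℝ} (hab : a < b) : HasTrace (bandOp a b) ((b - a : ℝ) : ℂ) :=
  hasTrace_of_hasSum (summable_band a b) (hasSum_bandOp a b) (hasSum_trace_bandOp hab)

/-! ### The sine kernel -/

theorem integral_exp_eq_sinc (c : ℝ) :
    ∫ ξ in Ioo (-(1 / 2 : ℝ)) (1 / 2), Complex.exp (((2 * Real.pi * c * ξ : ℝ) : ℂ) * Complex.I) =
      Real.sinc (Real.pi * c) := by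
  rw [← integral_Ioc_eq_integral_Ioo, ← intervalIntegral.integral_of_le (by norm_num)]
  -- The rescaling of the variable divides by `c`, so `c = 0` is treated apart.
  rcases eq_or_ne c 0 with rfl | hc
  · simp
    norm_num
  · have h := intervalIntegral.integral_comp_mul_left (a := -(1 / 2 : ℝ)) (b := 1 / 2)
      (fun t : ℝ => Complex.exp ((t : ℂ) * Complex.I)) (c := 2 * Real.pi * c)
      (mul_ne_zero (mul_ne_zero two_ne_zero Real.pi_ne_zero) hc)
    rw [h, show 2 * Real.pi * c * -(1 / 2) = -(Real.pi * c) by ring,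
      show 2 * Real.pi * c * (1 / 2) = Real.pi * c by ring, integral_exp_mul_I_eq_sinc,
      Complex.real_smul]
    have hpi : (Real.pi : ℂ) ≠ 0 := Complex.ofReal_ne_zero.2 Real.pi_ne_zero
    have hc' : (c : ℂ) ≠ 0 := Complex.ofReal_ne_zero.2 hc
    push_cast
    field_simp

theorem fourier_indicator_exp (x y : ℝ) :
    𝓕 ((Ioo (-(1 / 2 : ℝ)) (1 / 2)).indicator fun ξ : ℝ =>
      Complex.exp (((2 * Real.pi * x * ξ : ℝ) : ℂ) * Complex.I)) y =
      Real.sinc (Real.pi * (x - y)) := by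
  rw [Real.fourier_real_eq_integral_exp_smul, ← integral_exp_eq_sinc,
    ← integral_indicator measurableSet_Ioo]
  refine integral_congr_ae (ae_of_all _ fun ξ => ?_)
  by_cases h : ξ ∈ Ioo (-(1 / 2 : ℝ)) (1 / 2)
  · simp only [indicator_of_mem h, smul_eq_mul, ← Complex.exp_add]
    congr 1
    push_cast
    ring
  · simp only [indicator_of_notMem h, smul_zero]

/-- At fixed `x` the inverse transform pairs the Fourier transform of `f 1_{(a, b)}` with the
truncated exponential `e`. The multiplication formula moves the transform onto `e`, where it is a
sinc. -/
theorem bandOp_coeFn (a b : ℝ) (f : L2) : bandOp a b f =ᵐ[volume] fun x =>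
    ∫ y, (Ioo a b).indicator (fun y => (Real.sinc (Real.pi * (x - y)) : ℂ)) y * f y := by
  rw [bandOp_apply]
  refine (FT_symm_coeFn_of_integrable
    (memLp_indicator_Ioo (continuous_boxFourier a b f) (-(1 / 2)) (1 / 2))
    (integrable_indicator_Ioo (continuous_boxFourier a b f) _ _)).trans (ae_of_all _ fun x => ?_)
  set e : ℝ → ℂ := (Ioo (-(1 / 2 : ℝ)) (1 / 2)).indicator fun ξ : ℝ =>
    Complex.exp (((2 * Real.pi * x * ξ : ℝ) : ℂ) * Complex.I) with he
  have hei : Integrable e := integrable_indicator_Ioo (by fun_prop) _ _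
  have hflip : ∫ ξ, boxFourier a b f ξ • e ξ = ∫ y, (Ioo a b).indicator f y • 𝓕 e y := by
    simpa using! (VectorFourier.integral_fourierIntegral_smul_eq_flip (L := innerₗ ℝ)
      Real.continuous_fourierChar continuous_inner (integrable_indicator_L2 a b f) hei)
  calc 𝓕⁻ ((Ioo (-(1 / 2 : ℝ)) (1 / 2)).indicator (boxFourier a b f)) x
      = ∫ ξ, boxFourier a b f ξ • e ξ := by
        rw [Real.fourierInv_eq']
        refine integral_congr_ae (ae_of_all _ fun ξ => ?_)
        by_cases h : ξ ∈ Ioo (-(1 / 2 : ℝ)) (1 / 2)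
        · simp only [he, indicator_of_mem h, smul_eq_mul, RCLike.inner_apply, conj_trivial,
            mul_assoc]
          rw [mul_comm]
        · simp only [he, indicator_of_notMem h, smul_zero]
    _ = ∫ y, (Ioo a b).indicator f y • 𝓕 e y := hflip
    _ = _ := by
        refine integral_congr_ae (ae_of_all _ fun y => ?_)
        simp only [he, fourier_indicator_exp]
        by_cases h : y ∈ Ioo a b
        · simp only [indicator_of_mem h, smul_eq_mul, mul_comm]
        · simp only [indicator_of_notMem h, zero_smul, zero_mul]

theorem integrable_sinc_mul (a b : ℝ) (f : L2) (x : ℝ) : Integrable fun y =>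
    (Ioo a b).indicator (fun y => (Real.sinc (Real.pi * (x - y)) : ℂ)) y * f y := by
  have hm : AEStronglyMeasurable (fun y : ℝ => (Real.sinc (Real.pi * (x - y)) : ℂ)) volume :=
    (Complex.continuous_ofReal.comp (Real.continuous_sinc.comp
      (continuous_const.mul (continuous_const.sub continuous_id)))).aestronglyMeasurable
  have := (integrable_indicator_L2 a b f).bdd_mul (c := 1) hm (ae_of_all _ fun y => by
    rw [Complex.norm_real]
    exact Real.abs_sinc_le_one _)
  refine this.congr (ae_of_all _ fun y => ?_)
  by_cases h : y ∈ Ioo a b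
  · simp only [indicator_of_mem h]
  · simp only [indicator_of_notMem h, zero_mul, mul_zero]

/-! ### The Dyson kernel -/

theorem intervalIntegrable_dysonIntegrand (x y : ℝ) :
    IntervalIntegrable (dysonIntegrand x y) volume 0 (Real.pi ^ 2) := by
  -- The only singularity is `t^(-1/2)` at `0`, which is integrable; the remaining factor is
  -- continuous.
  have h := (intervalIntegral.intervalIntegrable_rpow' (a := 0) (b := Real.pi ^ 2)
    (r := -(1 / 2)) (by norm_num)).mul_continuousOn
    (g := fun t => Real.cos ((x - y) * Real.sqrt t) / (2 * Real.pi))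
    (Continuous.continuousOn (by fun_prop))
  refine h.congr fun t ht => ?_
  rw [uIoc_of_le (sq_nonneg _)] at ht
  simp only [dysonIntegrand]
  rw [Real.rpow_neg ht.1.le, ← Real.sqrt_eq_rpow]
  field_simp

/-- An antiderivative is `sin((x-y)√t) / (π(x-y))`, or `√t / π` on the diagonal. The square root is
not differentiable at `0`, so the fundamental theorem is used with continuity on the closed
interval, derivatives only inside, and integrability of the derivative. -/
theorem dysonKernel_eq_sinc (x y : ℝ) : dysonKernel x y = Real.sinc (Real.pi * (x - y)) := by
  have hpi := Real.pi_ne_zero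
  rcases eq_or_ne (x - y) 0 with h0 | h0
  · have hd : ∀ t ∈ Ioo 0 (Real.pi ^ 2),
        HasDerivAt (fun t => Real.sqrt t / Real.pi) (dysonIntegrand x y t) t := by
      intro t ht
      refine ((Real.hasDerivAt_sqrt ht.1.ne').div_const Real.pi).congr_deriv ?_
      rw [dysonIntegrand, h0, zero_mul, Real.cos_zero]
      field_simp
    rw [dysonKernel, intervalIntegral.integral_eq_sub_of_hasDerivAt_of_le (sq_nonneg _)
      (Continuous.continuousOn (by fun_prop)) hd (intervalIntegrable_dysonIntegrand x y),
      Real.sqrt_sq Real.pi_pos.le, h0]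
    simp
  · have hd : ∀ t ∈ Ioo 0 (Real.pi ^ 2), HasDerivAt
        (fun t => Real.sin ((x - y) * Real.sqrt t) / (Real.pi * (x - y)))
        (dysonIntegrand x y t) t := by
      intro t ht
      refine ((((Real.hasDerivAt_sqrt ht.1.ne').const_mul (x - y)).sin).div_const
        (Real.pi * (x - y))).congr_deriv ?_
      rw [dysonIntegrand]
      field_simp
    rw [dysonKernel, intervalIntegral.integral_eq_sub_of_hasDerivAt_of_le (sq_nonneg _)
      (Continuous.continuousOn (by fun_prop)) hd (intervalIntegrable_dysonIntegrand x y),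
      Real.sqrt_sq Real.pi_pos.le, Real.sinc_of_ne_zero (mul_ne_zero hpi h0)]
    simp [mul_comm]

theorem hasKernel_bandOp (a b : ℝ) :
    HasKernel (bandOp a b)
      fun x y => (Ioo a b).indicator (fun y => (dysonKernel x y : ℂ)) y := by
  intro f
  simp_rw [dysonKernel_eq_sinc]
  filter_upwards [bandOp_coeFn a b f] with x hx
  exact ⟨integrable_sinc_mul a b f x, hx⟩

end FreeLaplacian

end

theorem mainTheorem5 :
    IsEssentiallySelfAdjoint minimalOperator ∧
    ∃ L : L2 →ₗ.[ℂ] L2,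
      -- `L` is the unique self-adjoint extension
      (IsSelfAdjoint L ∧ minimalOperator ≤ L ∧
        ∀ L' : L2 →ₗ.[ℂ] L2, IsSelfAdjoint L' → minimalOperator ≤ L' → L' = L) ∧
      opSpectrum L = Complex.ofReal '' Set.Ici 0 ∧
      ∃ E : ProjectionValuedMeasure L2,
        -- `L = ∫ t dE(t)`
        IsSpectralResolution L E ∧
        acSpectrum L E = Complex.ofReal '' Set.Ici 0 ∧
        E.acSubspace = ⊤ ∧
        -- the operator `1_{(-∞, π²)}(L) 1_{(a, b)}`
        (∀ a b : ℝ, a < b →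
          IsTraceClass (E.proj (Set.Iio (Real.pi ^ 2)) ∘L indicatorMul a b) ∧
          HasTrace (E.proj (Set.Iio (Real.pi ^ 2)) ∘L indicatorMul a b) ((b - a : ℝ) : ℂ) ∧
          HasKernel (E.proj (Set.Iio (Real.pi ^ 2)) ∘L indicatorMul a b)
            (fun x y => (Set.Ioo a b).indicator (fun y => (dysonKernel x y : ℂ)) y)) ∧
        ∀ x y : ℝ,
          IntervalIntegrable (dysonIntegrand x y) MeasureTheory.volume 0 (Real.pi ^ 2) ∧
          dysonKernel x y = Real.sinc (Real.pi * (x - y)) := by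
  exact ⟨minimalOperator_isEssentiallySelfAdjoint, freeL,
    ⟨freeL_selfAdjoint, minimalOperator_le_freeL, fun _ => eq_freeL_of_selfAdjoint_extension⟩,
    opSpectrum_freeL, freePVM, isSpectralResolution_freeL, acSpectrum_freeL, freePVM_acSubspace,
    fun a b hab => ⟨isTraceClass_bandOp a b, hasTrace_bandOp hab, hasKernel_bandOp a b⟩,
    fun x y => ⟨intervalIntegrable_dysonIntegrand x y, dysonKernel_eq_sinc x y⟩⟩
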